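/- Let a buyer's valuation lie in $[0,1]$ and let the reference distribution $P_0$ be uniform on $[0,1]$. For probability distributions $P,P'$ on $[0,1]$ put $d(P,P')=\int_0^1|P((x,1])-P'((x,1])|\,dx$ (the type-1 Wasserstein distance). A mechanism is a pair $(q,m)$ with $q:[0,1]\to[0,1]$ and $m:[0,1]\to\mathbb{R}$ such that $q(v)v-m(v)\ge 0$ and $q(v)v-m(v)\ge q(\omega)v-m(\omega)$ for all $v,\omega\in[0,1]$. Fix a revenue target $\tau\in(0,1/4)$. The robust satisficing (RS) problem is to minimize $k$ over all $k>0$ and all mechanisms $(q,m)$ subject to $\tau-\mathbb{E}_{P}[m(\tilde v)]\le k\,d(P,P_0)$ for every probability distribution $P$ on $[0,1]$. The RS posted-price problem is the same problem restricted to $m(v)=p\,\mathbf{1}(v\ge p)$ with a price $p\in[0,1]$, that is, to minimize $k$ over all $k>0$ and $p\in[0,1]$ subject to $\tau-\mathbb{E}_P[p\,\mathbf{1}(\tilde v\ge p)]\le k\,d(P,P_0)$ for every such $P$. Both problems have optimal solutions. Let $(q^*_{RS},m^*_{RS})$ be an optimal mechanism of the RS problem with optimal fragility $k^*_{RS}$,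 and let $p^{PP}_{RS}$ be an optimal price of the RS posted-price problem. Then $(q^*_{RS},m^*_{RS})$ is implemented by a random price $\tilde p$ on $[0,1]$ with distribution function $q^*_{RS}$, in the sense that $q^*_{RS}(v)=\mathbb{P}(\tilde p\le v)$ and $m^*_{RS}(v)=\mathbb{E}[\tilde p\,\mathbf{1}(\tilde p\le v)]$ for all $v\in[0,1]$, and this optimal randomized price satisfies $$\mathbb{E}[\tilde p]=p^{PP}_{RS}=2\tau,\qquad \mathrm{Var}(\tilde p)=\tau(1-4\tau),$$ $$\mathrm{Skew}(\tilde p)=\frac{1}{\sqrt{\tau(1-4\tau)^3}}\left(\frac{2\tau^2}{3(k^*_{RS})^2}+\frac12-6\tau+16\tau^2\right),$$ where $\mathrm{Skew}(\tilde p)=\mathbb{E}\big[\big((\tilde p-\mathbb{E}[\tilde p])/\sqrt{\mathrm{Var}(\tilde p)}\big)^3\big]$. -/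

import Mathlib

open Set MeasureTheory ProbabilityTheory

noncomputable section

/-- The probability distributions supported on `[0,1]`. -/
def IsLawOnUnit (P : Measure ℝ) : Prop :=
  IsProbabilityMeasure P ∧ P (Icc (0 : ℝ) 1)ᶜ = 0

/-- The uniform distribution on `[0,1]`. -/
def uniformLaw : Measure ℝ := volume.restrict (Icc (0 : ℝ) 1)

/-- The complementary cumulative distribution function `x ↦ ℙ(v > x)`. -/
def ccdf (P : Measure ℝ) (x : ℝ) : ℝ := P.real (Ioi x)

/-- The type-1 Wasserstein distance between distributions on `[0,1]`, as the integral of the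
absolute difference of the complementary distribution functions. -/
def wassersteinDist (P P₀ : Measure ℝ) : ℝ :=
  ∫ x in (0 : ℝ)..1, |ccdf P x - ccdf P₀ x|

/-- Direct mechanisms: an allocation rule `q` and a payment rule `m` on `[0,1]` that are
individually rational and incentive compatible. Values outside `[0,1]` play no role. -/
structure IsMechanism (q m : ℝ → ℝ) : Prop where
  alloc_mem : ∀ v ∈ Icc (0 : ℝ) 1, q v ∈ Icc (0 : ℝ) 1
  rational : ∀ v ∈ Icc (0 : ℝ) 1, 0 ≤ q v * v - m v
  compatible : ∀ v ∈ Icc (0 : ℝ) 1, ∀ ω ∈ Icc (0 : ℝ) 1, q ω * v - m ω ≤ q v * v - m v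

/-- The satisficing constraint: under every valuation distribution on `[0,1]`, the shortfall of
the expected payment from the target `τ` is at most `k` times the distance to the reference. -/
def Satisfices (P₀ : Measure ℝ) (τ : ℝ) (m : ℝ → ℝ) (k : ℝ) : Prop :=
  ∀ P : Measure ℝ, IsLawOnUnit P → τ - ∫ v, m v ∂P ≤ k * wassersteinDist P P₀

/-- Feasibility in the robust satisficing problem over all mechanisms. -/
def IsFeasibleRS (P₀ : Measure ℝ) (τ k : ℝ) (q m : ℝ → ℝ) : Prop :=
  IsMechanism q m ∧ 0 < k ∧ Satisfices P₀ τ m k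

/-- `(q, m)` is an optimal robust satisficing mechanism, with optimal fragility `k`. -/
def IsOptimalRS (P₀ : Measure ℝ) (τ k : ℝ) (q m : ℝ → ℝ) : Prop :=
  IsFeasibleRS P₀ τ k q m ∧
    ∀ (k' : ℝ) (q' m' : ℝ → ℝ), IsFeasibleRS P₀ τ k' q' m' → k ≤ k'

/-- The payment rule of the posted price mechanism with price `p`: pay `p` if `v ≥ p`. -/
def postedPayment (p : ℝ) : ℝ → ℝ := (Ici p).indicator fun _ => p

/-- Feasibility in the robust satisficing problem over posted prices. -/
def IsFeasiblePP (P₀ : Measure ℝ) (τ k p : ℝ) : Prop :=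
  p ∈ Icc (0 : ℝ) 1 ∧ 0 < k ∧ Satisfices P₀ τ (postedPayment p) k

/-- `p` is an optimal robust satisficing posted price, with optimal fragility `k`. -/
def IsOptimalPP (P₀ : Measure ℝ) (τ k p : ℝ) : Prop :=
  IsFeasiblePP P₀ τ k p ∧ ∀ k' p' : ℝ, IsFeasiblePP P₀ τ k' p' → k ≤ k'

/-- Charging a random price with law `Q` on `[0,1]` implements the mechanism `(q, m)`: a buyer
with valuation `v` buys exactly when the price is at most `v`. In particular `q` is the
distribution function of the price. -/
def IsRandomizedPrice (Q : Measure ℝ) (q m : ℝ → ℝ) : Prop :=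
  IsLawOnUnit Q ∧ ∀ v ∈ Icc (0 : ℝ) 1, q v = Q.real (Iic v) ∧ m v = ∫ p in Iic v, p ∂Q

/-- The mean of a law on the real line. -/
def lawMean (Q : Measure ℝ) : ℝ := ∫ p, p ∂Q

/-- The variance of a law on the real line. -/
def lawVar (Q : Measure ℝ) : ℝ := variance (fun p : ℝ => p) Q

/-- The skewness of a law on the real line: its standardized third central moment. -/
def lawSkew (Q : Measure ℝ) : ℝ := ∫ p, ((p - lawMean Q) / √(lawVar Q)) ^ 3 ∂Q

end

/-! Choose `a ∈ (0, 1/2)` and `k > 0` with `k log ((1 - a) / a) = 1` and `k (1 - 2a) = 2τ`. The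
optimal random price has density `k / x` on `[a, 1 - a]`, so its payment rule has slope `k` there
and is flat elsewhere. The mean of such a primitive is an integral against the complementary
distribution function, and its loss relative to the uniform law is then at most `k` times the
distance (`satisfices_robustPayment`).

Optimality is certified by a single law, `hardLaw a`: uniform outside `[a, 1 - a]`, equal-revenue
inside. By the envelope formula no mechanism earns more than `a (1 - a)` under it, while `τ = a (1 -
a) + k d` with `d > 0` its distance to uniform. Hence no smaller fragility is feasible
(`fragility_ge`).

Uniqueness comes from equality at this law. A mechanism feasible at `k` must be revenue-optimal
under it, so its allocation is 0 below `a` and 1 above `1 - a`. The law has full support, so moving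
a little mass to the left shows that payments grow at rate at most `k`, and incentive compatibility
turns this into growth of the allocation by at most `k log`. The total rise allowed across `[a, 1 -
a]` is exactly 1, so every inequality is tight (`eqOn_robust_of_isFeasibleRS`). The moments of the
density `k / x` are then explicit.

For a posted price `p`, the damaging laws move the buyers just above `p` to just below it.
Optimizing over the moved mass gives a quadratic inequality in `p`, whose solvability bounds the
fragility and whose double root is `2τ`. -/

/-! ### Increment estimates without differentiability. -/

/-- A function whose increments are dominated by `(t - s) (g t - g s)` does not increase. -/
theorem le_of_sub_le_mul_sub {D g : ℝ → ℝ} {x y : ℝ} (hxy : x ≤ y)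
    (h : ∀ s ∈ Icc x y, ∀ t ∈ Icc x y, s ≤ t → D t - D s ≤ (t - s) * (g t - g s)) :
    D y ≤ D x := by
  -- On `n + 1` equal cells the factor `t - s` is constant and the increments of `g` telescope, so
  -- the total bound is of order `1 / (n + 1)`; no continuity of `D` or `g` is needed.
  have key : ∀ n : ℕ, D y - D x ≤ (y - x) * (g y - g x) / ((n : ℝ) + 1) := by
    intro n
    have hn : (0 : ℝ) < (n : ℝ) + 1 := by positivity
    set p : ℕ → ℝ := fun i => x + i * ((y - x) / (n + 1)) with hp
    have hstep : ∀ i, p (i + 1) - p i = (y - x) / (n + 1) := by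
      intro i; simp only [hp]; push_cast; ring
    have hp0 : p 0 = x := by simp [hp]
    have hpn : p (n + 1) = y := by simp only [hp]; push_cast; field_simp; ring
    have hd : 0 ≤ (y - x) / ((n : ℝ) + 1) := div_nonneg (by linarith) hn.le
    have hmem : ∀ i ≤ n + 1, p i ∈ Icc x y := by
      intro i hi
      have hi' : (i : ℝ) ≤ n + 1 := by exact_mod_cast hi
      refine ⟨le_add_of_nonneg_right (by positivity), ?_⟩
      rw [← hpn]
      simp only [hp]
      push_cast
      gcongr
    have e1 := Finset.sum_range_sub (fun i => D (p i)) (n + 1)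
    have e2 := Finset.sum_range_sub (fun i => g (p i)) (n + 1)
    rw [hp0, hpn] at e1 e2
    calc D y - D x = ∑ i ∈ Finset.range (n + 1), (D (p (i + 1)) - D (p i)) := e1.symm
      _ ≤ ∑ i ∈ Finset.range (n + 1), (y - x) / (n + 1) * (g (p (i + 1)) - g (p i)) := by
          refine Finset.sum_le_sum fun i hi => ?_
          have hi := Finset.mem_range.1 hi
          rw [← hstep i]
          exact h _ (hmem i hi.le) _ (hmem (i + 1) hi) (by linarith [hstep i])
      _ = (y - x) * (g y - g x) / ((n : ℝ) + 1) := by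
          rw [← Finset.mul_sum, e2]; ring
  have hlim : Filter.Tendsto (fun n : ℕ => (y - x) * (g y - g x) / ((n : ℝ) + 1))
      Filter.atTop (nhds 0) :=
    tendsto_const_nhds.div_atTop
      (Filter.tendsto_atTop_add_const_right _ _ tendsto_natCast_atTop_atTop)
  linarith [ge_of_tendsto' hlim key]

/-- A function whose increments are dominated in absolute value by `(t - s) (g t - g s)` is
constant. -/
theorem eq_of_abs_sub_le_mul_sub {D g : ℝ → ℝ} {x y : ℝ} (hxy : x ≤ y)
    (h : ∀ s ∈ Icc x y, ∀ t ∈ Icc x y, s ≤ t → |D t - D s| ≤ (t - s) * (g t - g s)) :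
    D y = D x := by
  refine le_antisymm (le_of_sub_le_mul_sub hxy fun s hs t ht hst =>
    (le_abs_self _).trans (h s hs t ht hst)) ?_
  have := le_of_sub_le_mul_sub (D := fun z => -D z) (g := g) hxy fun s hs t ht hst => by
    have := (neg_abs_le (D t - D s)).trans' (neg_le_neg (h s hs t ht hst)); linarith
  linarith

/-! ### Laws on the unit interval and the Wasserstein distance. -/

namespace IsLawOnUnit

variable {P : Measure ℝ}

theorem ae_mem (hP : IsLawOnUnit P) : ∀ᵐ v ∂P, v ∈ Icc (0 : ℝ) 1 := hP.2

theorem restrict_eq (hP : IsLawOnUnit P) : P.restrict (Icc 0 1) = P :=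
  Measure.restrict_eq_self_of_ae_mem hP.ae_mem

theorem integrable_of_monotoneOn (hP : IsLawOnUnit P) {f : ℝ → ℝ}
    (hf : MonotoneOn f (Icc 0 1)) : Integrable f P := by
  have := hP.1
  have := hf.integrableOn_of_measure_ne_top (μ := P) (isLeast_Icc zero_le_one)
    (isGreatest_Icc zero_le_one) (measure_ne_top _ _) measurableSet_Icc
  rwa [IntegrableOn, hP.restrict_eq] at this

theorem integrable_of_continuousOn (hP : IsLawOnUnit P) {f : ℝ → ℝ}
    (hf : ContinuousOn f (Icc 0 1)) : Integrable f P := by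
  have := hP.1
  have := hf.integrableOn_compact (μ := P) isCompact_Icc
  rwa [IntegrableOn, hP.restrict_eq] at this

/-- Fubini: the mean of a primitive is the integral of the integrand against the complementary
distribution function. -/
theorem integral_primitive (hP : IsLawOnUnit P) {f : ℝ → ℝ}
    (hf : IntervalIntegrable f volume 0 1) :
    ∫ v, (∫ x in (0 : ℝ)..v, f x) ∂P = ∫ x in (0 : ℝ)..1, f x * ccdf P x := by
  have := hP.1
  have hf' : Integrable f (volume.restrict (Ioc 0 1)) := by
    simpa [intervalIntegrable_iff, uIoc_of_le, IntegrableOn] using hf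
  -- The strict cutoff `x < v` makes the swapped inner integral equal to `f x` times the mass of
  -- `Ioi x`, which is the `ccdf` even when `P` has atoms.
  have hint : Integrable (Function.uncurry fun v x : ℝ => (Iio v).indicator f x)
      (P.prod (volume.restrict (Ioc 0 1))) := by
    have h1 : Integrable (fun z : ℝ × ℝ => f z.2) (P.prod (volume.restrict (Ioc 0 1))) :=
      hf'.comp_snd P
    have h2 : MeasurableSet {z : ℝ × ℝ | z.2 < z.1} := measurableSet_lt measurable_snd measurable_fst
    refine (h1.indicator h2).congr (Filter.Eventually.of_forall fun z => ?_)
    simp [Function.uncurry, indicator]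
  calc ∫ v, (∫ x in (0 : ℝ)..v, f x) ∂P
      = ∫ v, (∫ x in Ioc (0 : ℝ) 1, (Iio v).indicator f x) ∂P := by
        refine integral_congr_ae ?_
        filter_upwards [hP.ae_mem] with v hv
        rw [intervalIntegral.integral_of_le hv.1, integral_Ioc_eq_integral_Ioo,
          setIntegral_indicator measurableSet_Iio]
        congr 2
        ext x
        simp only [mem_Ioo, mem_inter_iff, mem_Ioc, mem_Iio]
        exact ⟨fun h => ⟨⟨h.1, h.2.le.trans hv.2⟩, h.2⟩, fun h => ⟨h.1.1, h.2⟩⟩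
    _ = ∫ x in Ioc (0 : ℝ) 1, (∫ v, (Iio v).indicator f x ∂P) := integral_integral_swap hint
    _ = ∫ x in (0 : ℝ)..1, f x * ccdf P x := by
        rw [intervalIntegral.integral_of_le zero_le_one]
        refine integral_congr_ae (Filter.Eventually.of_forall fun x => ?_)
        have : (fun v => (Iio v).indicator f x) = (Ioi x).indicator fun _ => f x := by
          ext v; simp [indicator]
        simp only [this, integral_indicator_const _ measurableSet_Ioi, ccdf, smul_eq_mul, mul_comm]

/-- The mean is the integral of the complementary distribution function. -/
theorem integral_ccdf (hP : IsLawOnUnit P) : ∫ x in (0 : ℝ)..1, ccdf P x = ∫ v, v ∂P := by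
  have := hP.integral_primitive (f := fun _ => 1) (by simp)
  simpa using this.symm

end IsLawOnUnit

theorem antitone_ccdf (P : Measure ℝ) [IsFiniteMeasure P] : Antitone (ccdf P) :=
  fun _ _ h => measureReal_mono (Ioi_subset_Ioi h)

theorem intervalIntegrable_ccdf (P : Measure ℝ) [IsFiniteMeasure P] (a b : ℝ) :
    IntervalIntegrable (ccdf P) volume a b :=
  (antitone_ccdf P).intervalIntegrable

theorem wassersteinDist_nonneg (P P₀ : Measure ℝ) : 0 ≤ wassersteinDist P P₀ :=
  intervalIntegral.integral_nonneg zero_le_one fun _ _ => abs_nonneg _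

theorem wassersteinDist_triangle (P R S : Measure ℝ) [IsFiniteMeasure P] [IsFiniteMeasure R]
    [IsFiniteMeasure S] :
    wassersteinDist P S ≤ wassersteinDist P R + wassersteinDist R S := by
  have i1 := ((intervalIntegrable_ccdf P 0 1).sub (intervalIntegrable_ccdf R 0 1)).abs
  have i2 := ((intervalIntegrable_ccdf R 0 1).sub (intervalIntegrable_ccdf S 0 1)).abs
  have i3 := ((intervalIntegrable_ccdf P 0 1).sub (intervalIntegrable_ccdf S 0 1)).abs
  rw [wassersteinDist, wassersteinDist, wassersteinDist, ← intervalIntegral.integral_add i1 i2]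
  exact intervalIntegral.integral_mono_on zero_le_one i3 (i1.add i2) fun x _ =>
    abs_sub_le _ _ _

/-! ### Moving mass to the left. -/

/-- Moving the mass that `P` puts on `B` to the point `s`. -/
noncomputable def relocate (P : Measure ℝ) (B : Set ℝ) (s : ℝ) : Measure ℝ :=
  P.restrict Bᶜ + P B • Measure.dirac s

section relocate

variable {P : Measure ℝ} {B : Set ℝ} {s : ℝ}

theorem isLawOnUnit_relocate (hP : IsLawOnUnit P) (hB : MeasurableSet B)
    (hs : s ∈ Icc (0 : ℝ) 1) : IsLawOnUnit (relocate P B s) := by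
  have := hP.1
  refine ⟨⟨?_⟩, ?_⟩
  · simp only [relocate, Measure.add_apply, Measure.smul_apply, smul_eq_mul, measure_univ, mul_one,
      Measure.restrict_apply_univ]
    rw [add_comm, measure_add_measure_compl hB, measure_univ]
  · have h1 : P.restrict Bᶜ (Icc (0 : ℝ) 1)ᶜ = 0 :=
      le_antisymm ((Measure.restrict_apply_le _ _).trans hP.2.le) zero_le
    have h2 : Measure.dirac s (Icc (0 : ℝ) 1)ᶜ = 0 := by
      rw [Measure.dirac_apply' _ measurableSet_Icc.compl]; simp [hs.1, hs.2]
    simp [relocate, h1, h2]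

theorem integral_relocate (hP : IsLawOnUnit P) (hB : MeasurableSet B) {g : ℝ → ℝ}
    (hg : Integrable g P) :
    ∫ v, g v ∂(relocate P B s) = ∫ v, g v ∂P - ∫ v in B, g v ∂P + P.real B * g s := by
  have := hP.1
  have hd : Integrable g (P B • Measure.dirac s) :=
    (integrable_dirac (by simp)).smul_measure (measure_ne_top _ _)
  rw [relocate, integral_add_measure hg.restrict hd, integral_smul_measure, integral_dirac,
    ← integral_add_compl hB hg, smul_eq_mul, Measure.real]
  ring

theorem ccdf_relocate_le (hP : IsLawOnUnit P) (hB : MeasurableSet B)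
    (hsB : ∀ b ∈ B, s ≤ b) (x : ℝ) : ccdf (relocate P B s) x ≤ ccdf P x := by
  have := hP.1
  have h := integral_relocate (s := s) hP hB
    ((integrable_const (1 : ℝ)).indicator (measurableSet_Ioi (a := x)))
  rw [integral_indicator_const _ measurableSet_Ioi, integral_indicator_const _ measurableSet_Ioi,
    setIntegral_indicator measurableSet_Ioi, setIntegral_const] at h
  simp only [smul_eq_mul, mul_one] at h
  rw [ccdf, ccdf, h]
  by_cases hx : x < s
  · have : B ∩ Ioi x = B := inter_eq_left.2 fun b hb => hx.trans_le (hsB b hb)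
    rw [this, indicator_of_mem (mem_Ioi.2 hx)]; linarith
  · rw [indicator_of_notMem (by simpa using hx)]
    have := measureReal_nonneg (μ := P) (s := B ∩ Ioi x)
    linarith

/-- Moving mass to the left costs its mean displacement. -/
theorem wassersteinDist_relocate (hP : IsLawOnUnit P) (hB : MeasurableSet B)
    (hs : s ∈ Icc (0 : ℝ) 1) (hsB : ∀ b ∈ B, s ≤ b) :
    wassersteinDist (relocate P B s) P = ∫ v in B, v ∂P - P.real B * s := by
  have := hP.1
  have hR := isLawOnUnit_relocate hP hB hs
  have := hR.1
  have e : ∀ x, |ccdf (relocate P B s) x - ccdf P x| = ccdf P x - ccdf (relocate P B s) x :=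
    fun x => by
      rw [abs_sub_comm, abs_of_nonneg (sub_nonneg.2 (ccdf_relocate_le hP hB hsB x))]
  rw [wassersteinDist]
  simp only [e]
  rw [intervalIntegral.integral_sub (intervalIntegrable_ccdf _ _ _) (intervalIntegrable_ccdf _ _ _),
    hP.integral_ccdf, hR.integral_ccdf,
    integral_relocate hP hB (g := fun v => v) (hP.integrable_of_continuousOn continuousOn_id)]
  ring

end relocate

/-! ### The uniform law and laws with a density. -/

theorem isLawOnUnit_uniformLaw : IsLawOnUnit uniformLaw := by
  refine ⟨⟨by simp [uniformLaw]⟩, ?_⟩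
  rw [uniformLaw, Measure.restrict_apply measurableSet_Icc.compl]
  simp

theorem ccdf_uniformLaw {x : ℝ} (hx : x ∈ Icc (0 : ℝ) 1) : ccdf uniformLaw x = 1 - x := by
  have : Ioi x ∩ Icc 0 1 = Ioc x 1 := by
    ext y
    simp only [mem_inter_iff, mem_Ioi, mem_Icc, mem_Ioc]
    exact ⟨fun h => ⟨h.1, h.2.2⟩, fun h => ⟨h.1, hx.1.trans h.1.le, h.2⟩⟩
  rw [ccdf, Measure.real, uniformLaw, Measure.restrict_apply measurableSet_Ioi, this,
    Real.volume_Ioc, ENNReal.toReal_ofReal (by linarith [hx.2])]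

/-- The law on `[0,1]` with density `f`. -/
noncomputable def densityLaw (f : ℝ → ℝ) : Measure ℝ :=
  (volume.restrict (Icc (0 : ℝ) 1)).withDensity fun x => ENNReal.ofReal (f x)

section densityLaw

variable {f : ℝ → ℝ}

theorem integral_densityLaw (hf : IntervalIntegrable f volume 0 1) (h0 : ∀ x ∈ Icc (0 : ℝ) 1, 0 ≤ f x)
    (g : ℝ → ℝ) : ∫ v, g v ∂(densityLaw f) = ∫ v in (0 : ℝ)..1, f v * g v := by
  have hm : AEMeasurable f (volume.restrict (Icc 0 1)) := by
    have := (intervalIntegrable_iff_integrableOn_Icc_of_le zero_le_one).1 hf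
    exact this.aestronglyMeasurable.aemeasurable
  rw [densityLaw, integral_withDensity_eq_integral_toReal_smul₀ hm.ennreal_ofReal
    (Filter.Eventually.of_forall fun _ => ENNReal.ofReal_lt_top),
    intervalIntegral.integral_of_le zero_le_one, ← integral_Icc_eq_integral_Ioc]
  refine setIntegral_congr_fun measurableSet_Icc fun x hx => ?_
  simp [ENNReal.toReal_ofReal (h0 x hx)]

theorem isLawOnUnit_densityLaw (hf : IntervalIntegrable f volume 0 1)
    (h0 : ∀ x ∈ Icc (0 : ℝ) 1, 0 ≤ f x) (h1 : ∫ x in (0 : ℝ)..1, f x = 1) :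
    IsLawOnUnit (densityLaw f) := by
  refine ⟨⟨?_⟩, ?_⟩
  · have := (intervalIntegrable_iff_integrableOn_Icc_of_le zero_le_one).1 hf
    rw [densityLaw, withDensity_apply _ MeasurableSet.univ, Measure.restrict_univ,
      ← ofReal_integral_eq_lintegral_ofReal this
        ((ae_restrict_iff' measurableSet_Icc).2 (Filter.Eventually.of_forall h0)),
      integral_Icc_eq_integral_Ioc, ← intervalIntegral.integral_of_le zero_le_one, h1,
      ENNReal.ofReal_one]
  · refine withDensity_absolutelyContinuous _ _ ?_
    rw [Measure.restrict_apply measurableSet_Icc.compl]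
    simp

theorem real_densityLaw (hf : IntervalIntegrable f volume 0 1)
    (h0 : ∀ x ∈ Icc (0 : ℝ) 1, 0 ≤ f x) {A : Set ℝ} (hA : MeasurableSet A) {a b : ℝ}
    (hab : a ≤ b) (h : A ∩ Ioc 0 1 = Ioc a b) :
    (densityLaw f).real A = ∫ x in a..b, f x := by
  rw [← integral_indicator_one hA, integral_densityLaw hf h0,
    intervalIntegral.integral_of_le zero_le_one, intervalIntegral.integral_of_le hab]
  have e : (fun v => f v * A.indicator 1 v) = A.indicator f := by
    ext v; by_cases hv : v ∈ A <;> simp [hv]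
  rw [e, setIntegral_indicator hA, inter_comm, h]

theorem ccdf_densityLaw (hf : IntervalIntegrable f volume 0 1)
    (h0 : ∀ x ∈ Icc (0 : ℝ) 1, 0 ≤ f x) {x : ℝ} (hx : x ∈ Icc (0 : ℝ) 1) :
    ccdf (densityLaw f) x = ∫ y in x..1, f y := by
  refine real_densityLaw hf h0 measurableSet_Ioi hx.2 ?_
  ext y
  simp only [mem_inter_iff, mem_Ioi, mem_Ioc]
  exact ⟨fun h => ⟨h.1, h.2.2⟩, fun h => ⟨h.1, hx.1.trans_lt h.1, h.2⟩⟩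

theorem real_Iic_densityLaw (hf : IntervalIntegrable f volume 0 1)
    (h0 : ∀ x ∈ Icc (0 : ℝ) 1, 0 ≤ f x) {x : ℝ} (hx : x ∈ Icc (0 : ℝ) 1) :
    (densityLaw f).real (Iic x) = ∫ y in (0 : ℝ)..x, f y := by
  refine real_densityLaw hf h0 measurableSet_Iic hx.1 ?_
  ext y
  simp only [mem_inter_iff, mem_Iic, mem_Ioc]
  exact ⟨fun h => ⟨h.2.1, h.1⟩, fun h => ⟨h.2, h.1, h.2.trans hx.2⟩⟩

theorem setIntegral_Iic_densityLaw (hf : IntervalIntegrable f volume 0 1)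
    (h0 : ∀ x ∈ Icc (0 : ℝ) 1, 0 ≤ f x) {x : ℝ} (hx : x ∈ Icc (0 : ℝ) 1) (g : ℝ → ℝ) :
    ∫ v in Iic x, g v ∂(densityLaw f) = ∫ y in (0 : ℝ)..x, f y * g y := by
  rw [← integral_indicator measurableSet_Iic, integral_densityLaw hf h0,
    intervalIntegral.integral_of_le zero_le_one, intervalIntegral.integral_of_le hx.1]
  have e : (fun v => f v * (Iic x).indicator g v) = (Iic x).indicator fun v => f v * g v := by
    ext v; by_cases hv : v ≤ x <;> simp [hv]
  rw [e, setIntegral_indicator measurableSet_Iic]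
  congr 2
  ext y
  simp only [mem_inter_iff, mem_Iic, mem_Ioc]
  exact ⟨fun h => ⟨h.1.1, h.2⟩, fun h => ⟨⟨h.1, h.2.trans hx.2⟩, h.2⟩⟩

end densityLaw

/-! ### Calculus of functions defined piecewise on an interval. -/

/-- The nearest point of `[a, b]`. -/
noncomputable def clamp (a b x : ℝ) : ℝ := max a (min b x)

section clamp

variable {a b x : ℝ}

theorem continuous_clamp (a b : ℝ) : Continuous (clamp a b) := by unfold clamp; fun_prop

theorem clamp_mem (hab : a ≤ b) (x : ℝ) : clamp a b x ∈ Icc a b :=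
  ⟨le_max_left _ _, max_le hab (min_le_left _ _)⟩

theorem clamp_of_mem (hx : x ∈ Icc a b) : clamp a b x = x := by
  rw [clamp, min_eq_right hx.2, max_eq_right hx.1]

theorem clamp_of_le (hx : x ≤ a) : clamp a b x = a :=
  max_eq_left ((min_le_right _ _).trans hx)

theorem clamp_of_ge (hab : a ≤ b) (hx : b ≤ x) : clamp a b x = b := by
  rw [clamp, min_eq_left hx, max_eq_right hab]

end clamp

/-- The function equal to `f` on `[a, b]` and to `g` elsewhere. -/
noncomputable def splice (a b : ℝ) (f g : ℝ → ℝ) (x : ℝ) : ℝ :=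
  if a ≤ x ∧ x ≤ b then f x else g x

section splice

variable {a b : ℝ} {f g F : ℝ → ℝ}

theorem splice_of_mem {x : ℝ} (hx : x ∈ Icc a b) : splice a b f g x = f x := if_pos hx

theorem splice_of_notMem {x : ℝ} (hx : x ∉ Icc a b) : splice a b f g x = g x := if_neg hx

theorem intervalIntegrable_splice (hf : ContinuousOn f (Icc a b)) (hg : Continuous g) (u v : ℝ) :
    IntervalIntegrable (splice a b f g) volume u v := by
  classical
  have h1 : IntegrableOn f (Icc a b) (volume.restrict (uIoc u v)) :=
    (hf.integrableOn_compact isCompact_Icc).mono_measure Measure.restrict_le_self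
  have h2 : IntegrableOn g (Icc a b)ᶜ (volume.restrict (uIoc u v)) :=
    (intervalIntegrable_iff.1 (hg.intervalIntegrable u v)).integrableOn
  rw [intervalIntegrable_iff, IntegrableOn]
  refine (Integrable.piecewise measurableSet_Icc h1 h2).congr
    (Filter.Eventually.of_forall fun x => ?_)
  simp only [piecewise, splice, mem_Icc]

/-- The function `F (clamp x) + d (x - clamp x)` is a continuous primitive away from the two points
`a` and `b`. Stating the result through `clamp` avoids a case distinction on the endpoints. -/
theorem integral_splice (hab : a ≤ b) (hf : ContinuousOn f (Icc a b))
    (hF : ∀ x ∈ Icc a b, HasDerivAt F (f x) x) (d u v : ℝ) :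
    ∫ x in u..v, splice a b f (fun _ => d) x =
      F (clamp a b v) - F (clamp a b u) + d * ((v - clamp a b v) - (u - clamp a b u)) := by
  have hc := continuous_clamp a b
  have := integral_eq_of_hasDerivAt_off_countable
    (fun x => F (clamp a b x) + d * (x - clamp a b x)) (splice a b f fun _ => d) (a := u) (b := v)
    (s := {a, b}) (by simp) ?_ ?_ (intervalIntegrable_splice hf continuous_const u v)
  · rw [this]; ring
  · refine ContinuousOn.add ?_ (by fun_prop)
    intro x _
    exact ((hF _ (clamp_mem hab x)).continuousAt.comp hc.continuousAt).continuousWithinAt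
  · rintro x ⟨-, hx⟩
    simp only [mem_insert_iff, mem_singleton_iff, not_or] at hx
    rcases lt_or_gt_of_ne hx.1 with h | h
    · rw [splice_of_notMem fun h' => h.not_ge h'.1]
      have : HasDerivAt (fun x => F a + d * (x - a)) d x := by
        simpa using (((hasDerivAt_id x).sub_const a).const_mul d).const_add (F a)
      refine this.congr_of_eventuallyEq ?_
      filter_upwards [Iio_mem_nhds h] with y hy
      rw [clamp_of_le (le_of_lt hy)]
    rcases lt_or_gt_of_ne hx.2 with h' | h'
    · rw [splice_of_mem ⟨h.le, h'.le⟩]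
      refine (hF x ⟨h.le, h'.le⟩).congr_of_eventuallyEq ?_
      filter_upwards [Ioo_mem_nhds h h'] with y hy
      rw [clamp_of_mem ⟨hy.1.le, hy.2.le⟩]; ring
    · rw [splice_of_notMem fun h'' => h'.not_ge h''.2]
      have : HasDerivAt (fun x => F b + d * (x - b)) d x := by
        simpa using (((hasDerivAt_id x).sub_const b).const_mul d).const_add (F b)
      refine this.congr_of_eventuallyEq ?_
      filter_upwards [Ioi_mem_nhds h'] with y hy
      rw [clamp_of_ge hab (le_of_lt hy)]

end splice

/-! ### Incentive compatibility and the envelope formula. -/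

namespace IsMechanism

variable {q m : ℝ → ℝ}

theorem mul_alloc_sub_le (h : IsMechanism q m) {s t : ℝ} (hs : s ∈ Icc (0 : ℝ) 1)
    (ht : t ∈ Icc (0 : ℝ) 1) : s * (q t - q s) ≤ m t - m s := by
  linarith [h.compatible s hs t ht]

theorem monotoneOn_alloc (h : IsMechanism q m) : MonotoneOn q (Icc 0 1) := by
  intro s hs t ht hst
  rcases hst.eq_or_lt with rfl | hst
  · rfl
  have h1 := h.mul_alloc_sub_le hs ht
  have h2 := h.mul_alloc_sub_le ht hs
  have : 0 ≤ (t - s) * (q t - q s) := by linarith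
  linarith [nonneg_of_mul_nonneg_right this (sub_pos.2 hst)]

theorem monotoneOn_payment (h : IsMechanism q m) : MonotoneOn m (Icc 0 1) := by
  intro s hs t ht hst
  have h1 := h.mul_alloc_sub_le hs ht
  have := mul_nonneg hs.1 (sub_nonneg.2 (h.monotoneOn_alloc hs ht hst))
  linarith

theorem intervalIntegrable_alloc (h : IsMechanism q m) {s t : ℝ} (hs : s ∈ Icc (0 : ℝ) 1)
    (ht : t ∈ Icc (0 : ℝ) 1) : IntervalIntegrable q volume s t :=
  (h.monotoneOn_alloc.mono (ordConnected_Icc.uIcc_subset hs ht)).intervalIntegrable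

theorem intervalIntegrable_alloc_mul (h : IsMechanism q m) {g : ℝ → ℝ}
    (hg : IntervalIntegrable g volume 0 1) :
    IntervalIntegrable (fun x => q x * g x) volume 0 1 := by
  have hq := h.intervalIntegrable_alloc (s := 0) (t := 1) (by simp) (by simp)
  rw [intervalIntegrable_iff] at hg hq ⊢
  refine Integrable.bdd_mul (c := 1) hg hq.aestronglyMeasurable ?_
  refine (ae_restrict_iff' measurableSet_uIoc).2 (Filter.Eventually.of_forall fun x hx => ?_)
  rw [uIoc_of_le zero_le_one] at hx
  have := h.alloc_mem x ⟨hx.1.le, hx.2⟩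
  rw [Real.norm_eq_abs, abs_le]
  exact ⟨by linarith [this.1], this.2⟩

/-- The envelope formula. -/
theorem payment_eq (h : IsMechanism q m) {v : ℝ} (hv : v ∈ Icc (0 : ℝ) 1) :
    m v = m 0 + q v * v - ∫ x in (0 : ℝ)..v, q x := by
  have h0 : (0 : ℝ) ∈ Icc (0 : ℝ) 1 := by simp
  -- Both the buyer's utility and the integral of `q` increase from `s` to `t` by an amount between
  -- `(t - s) q s` and `(t - s) q t`, so their difference is constant.
  have := eq_of_abs_sub_le_mul_sub (D := fun x => q x * x - m x - ∫ y in (0 : ℝ)..x, q y) (g := q)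
    hv.1 ?_
  · simp only [mul_zero, intervalIntegral.integral_same] at this
    linarith
  · intro s hs t ht hst
    have hs' : s ∈ Icc (0 : ℝ) 1 := ⟨hs.1, hs.2.trans hv.2⟩
    have ht' : t ∈ Icc (0 : ℝ) 1 := ⟨ht.1, ht.2.trans hv.2⟩
    have hmono := h.monotoneOn_alloc
    have e : ∫ y in s..t, q y = (∫ y in (0 : ℝ)..t, q y) - ∫ y in (0 : ℝ)..s, q y :=
      (intervalIntegral.integral_interval_sub_left (h.intervalIntegrable_alloc h0 ht')
        (h.intervalIntegrable_alloc h0 hs')).symm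
    have sub : ∀ y ∈ Icc s t, y ∈ Icc (0 : ℝ) 1 := fun y hy =>
      ⟨hs'.1.trans hy.1, hy.2.trans ht'.2⟩
    have lo : (t - s) * q s ≤ ∫ y in s..t, q y := by
      have := intervalIntegral.integral_mono_on hst (intervalIntegrable_const (c := q s))
        (h.intervalIntegrable_alloc hs' ht') fun y hy => hmono hs' (sub y hy) hy.1
      simpa using this
    have hi : ∫ y in s..t, q y ≤ (t - s) * q t := by
      have := intervalIntegral.integral_mono_on hst (h.intervalIntegrable_alloc hs' ht')
        (intervalIntegrable_const (c := q t)) fun y hy => hmono (sub y hy) ht' hy.2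
      simpa using this
    have h1 := h.mul_alloc_sub_le hs' ht'
    have h2 := h.mul_alloc_sub_le ht' hs'
    rw [abs_le]
    constructor <;> linarith

/-- The allocation rule determines the payments up to a constant. -/
theorem payment_congr (h : IsMechanism q m) {q' m' : ℝ → ℝ} (h' : IsMechanism q' m')
    (hq : EqOn q q' (Icc 0 1)) (h0 : m 0 = m' 0) : EqOn m m' (Icc 0 1) := by
  intro v hv
  rw [h.payment_eq hv, h'.payment_eq hv, h0, hq hv]
  congr 1
  refine intervalIntegral.integral_congr fun x hx => hq ?_
  rw [uIcc_of_le hv.1] at hx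
  exact ⟨hx.1, hx.2.trans hv.2⟩

/-- The expected payment against a law on `[0,1]` in terms of the allocation rule. -/
theorem integral_payment (h : IsMechanism q m) {P : Measure ℝ} (hP : IsLawOnUnit P) :
    ∫ v, m v ∂P = m 0 + ∫ v, q v * v ∂P - ∫ x in (0 : ℝ)..1, q x * ccdf P x := by
  have := hP.1
  have hm := hP.integrable_of_monotoneOn h.monotoneOn_payment
  have hqv : Integrable (fun v => q v * v) P := hP.integrable_of_monotoneOn fun s hs t ht hst =>
    mul_le_mul (h.monotoneOn_alloc hs ht hst) hst hs.1 (h.alloc_mem t ht).1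
  rw [← hP.integral_primitive (h.intervalIntegrable_alloc (by simp) (by simp))]
  have : ∫ v, (∫ x in (0 : ℝ)..v, q x) ∂P = ∫ v, (m 0 + q v * v - m v) ∂P := by
    refine integral_congr_ae ?_
    filter_upwards [hP.ae_mem] with v hv
    linarith [h.payment_eq hv]
  have e : ∫ v, (m 0 + q v * v - m v) ∂P = m 0 + ∫ v, q v * v ∂P - ∫ v, m v ∂P := by
    rw [integral_sub (f := fun v => m 0 + q v * v) ((integrable_const _).add hqv) hm,
      integral_add (integrable_const _) hqv]
    simp
  rw [this, e]
  ring

end IsMechanism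

/-- Charging a random price is individually rational and incentive compatible. -/
theorem IsRandomizedPrice.isMechanism {Q : Measure ℝ} {q m : ℝ → ℝ} (h : IsRandomizedPrice Q q m) :
    IsMechanism q m := by
  obtain ⟨hQ, hqm⟩ := h
  have := hQ.1
  have hid : Integrable (fun p : ℝ => p) Q := hQ.integrable_of_continuousOn continuousOn_id
  have hint : ∀ v, Integrable (fun p : ℝ => v - p) Q := fun v => (integrable_const v).sub hid
  -- Reporting `ω` means buying at prices up to `ω`; for every price separately, the report `ω = v`
  -- maximizes the gain.
  have key : ∀ v, ∀ ω ∈ Icc (0 : ℝ) 1, q ω * v - m ω = ∫ p, (Iic ω).indicator (fun p => v - p) p ∂Q := by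
    intro v ω hω
    rw [integral_indicator measurableSet_Iic,
      integral_sub (integrable_const v).integrableOn hid.integrableOn, setIntegral_const,
      (hqm ω hω).1, (hqm ω hω).2, smul_eq_mul]
  refine ⟨fun v hv => ?_, fun v hv => ?_, fun v hv ω hω => ?_⟩
  · rw [(hqm v hv).1]
    exact ⟨measureReal_nonneg, measureReal_le_one⟩
  · rw [key v v hv]
    refine integral_nonneg fun p => indicator_nonneg (fun p hp => ?_) p
    exact sub_nonneg.2 hp
  · rw [key v v hv, key v ω hω]
    refine integral_mono ((hint v).indicator measurableSet_Iic)
      ((hint v).indicator measurableSet_Iic) fun p => ?_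
    simp only [indicator, mem_Iic]
    split_ifs <;> linarith

/-! ### The least favourable law and its optimal mechanisms. -/

/-- The density of the least favourable law. -/
noncomputable def hardDensity (a : ℝ) : ℝ → ℝ :=
  splice a (1 - a) (fun x => a * (1 - a) / x ^ 2) fun _ => 1

/-- The least favourable law: it coincides with the uniform law outside `[a, 1 - a]`, and on
`[a, 1 - a]` every posted price earns the same revenue. -/
noncomputable def hardLaw (a : ℝ) : Measure ℝ := densityLaw (hardDensity a)

section hardLaw

variable {a : ℝ}

theorem continuousOn_mid (ha : 0 < a) :
    ContinuousOn (fun x : ℝ => a * (1 - a) / x ^ 2) (Icc a (1 - a)) :=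
  continuousOn_const.div (by fun_prop) fun x hx => by have := ha.trans_le hx.1; positivity

theorem intervalIntegrable_hardDensity (ha : 0 < a) (u v : ℝ) :
    IntervalIntegrable (hardDensity a) volume u v :=
  intervalIntegrable_splice (continuousOn_mid ha) continuous_const u v

theorem integral_hardDensity (ha : 0 < a) (ha' : a < 1 / 2) (u : ℝ) :
    ∫ x in u..1, hardDensity a x =
      a * (1 - a) / clamp a (1 - a) u + clamp a (1 - a) u - u := by
  have h1a : 0 < 1 - a := by linarith
  rw [hardDensity, integral_splice (F := fun x => -(a * (1 - a) / x)) (by linarith)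
    (continuousOn_mid ha), clamp_of_ge (x := 1) (by linarith) (by linarith)]
  · have : a * (1 - a) / (1 - a) = a := by field_simp
    rw [this]; ring
  · intro x hx
    have hx0 : x ≠ 0 := (ha.trans_le hx.1).ne'
    have := ((hasDerivAt_inv hx0).const_mul (a * (1 - a))).neg
    simp only [← div_eq_mul_inv] at this
    refine this.congr_deriv ?_
    ring

/-- A crude bound, but uniform in `x`: it gives the least favourable law full support. -/
theorem hardDensity_pos (ha : 0 < a) (ha' : a < 1 / 2) (x : ℝ) :
    a * (1 - a) ≤ hardDensity a x := by
  have : 0 < 1 - a := by linarith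
  by_cases hx : x ∈ Icc a (1 - a)
  · have hx0 := ha.trans_le hx.1
    rw [hardDensity, splice_of_mem hx, le_div_iff₀ (by positivity)]
    have : x ^ 2 ≤ 1 := by nlinarith [hx.2]
    nlinarith [mul_pos ha ‹0 < 1 - a›]
  · rw [hardDensity, splice_of_notMem hx]; nlinarith

theorem hardDensity_nonneg (ha : 0 < a) (ha' : a < 1 / 2) (x : ℝ) : 0 ≤ hardDensity a x :=
  (mul_pos ha (by linarith)).le.trans (hardDensity_pos ha ha' x)

theorem isLawOnUnit_hardLaw (ha : 0 < a) (ha' : a < 1 / 2) : IsLawOnUnit (hardLaw a) := by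
  refine isLawOnUnit_densityLaw (intervalIntegrable_hardDensity ha _ _)
    (fun x _ => hardDensity_nonneg ha ha' x) ?_
  rw [integral_hardDensity ha ha', clamp_of_le ha.le]
  field_simp; ring

theorem ccdf_hardLaw (ha : 0 < a) (ha' : a < 1 / 2) {x : ℝ} (hx : x ∈ Icc (0 : ℝ) 1) :
    ccdf (hardLaw a) x = splice a (1 - a) (fun x => a * (1 - a) / x) (fun x => 1 - x) x := by
  have h1a : 0 < 1 - a := by linarith
  rw [hardLaw, ccdf_densityLaw (intervalIntegrable_hardDensity ha _ _)
    (fun x _ => hardDensity_nonneg ha ha' x) hx, integral_hardDensity ha ha']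
  by_cases h : x ∈ Icc a (1 - a)
  · rw [splice_of_mem h, clamp_of_mem h]; ring
  · rw [splice_of_notMem h]
    rcases lt_or_ge x a with h' | h'
    · rw [clamp_of_le h'.le]; field_simp; ring
    · have : 1 - a < x := by by_contra! h''; exact h ⟨h', h''⟩
      rw [clamp_of_ge (by linarith) this.le]; field_simp; ring

theorem wassersteinDist_hardLaw (ha : 0 < a) (ha' : a < 1 / 2) :
    wassersteinDist (hardLaw a) uniformLaw =
      (1 - 2 * a) / 2 - a * (1 - a) * (Real.log (1 - a) - Real.log a) := by
  have e : wassersteinDist (hardLaw a) uniformLaw = ∫ x in (0 : ℝ)..1,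
      splice a (1 - a) (fun x => 1 - x - a * (1 - a) / x) (fun _ => 0) x := by
    refine intervalIntegral.integral_congr fun x hx => ?_
    rw [uIcc_of_le zero_le_one] at hx
    simp only [ccdf_uniformLaw hx, ccdf_hardLaw ha ha' hx]
    by_cases h : x ∈ Icc a (1 - a)
    · have hx0 := ha.trans_le h.1
      rw [splice_of_mem h, splice_of_mem h, abs_sub_comm, abs_of_nonneg]
      rw [sub_nonneg, div_le_iff₀ hx0]
      nlinarith [h.1, h.2]
    · rw [splice_of_notMem h, splice_of_notMem h, sub_self, abs_zero]
  rw [e, integral_splice (F := fun x => x - x ^ 2 / 2 - a * (1 - a) * Real.log x) (by linarith),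
    clamp_of_le ha.le, clamp_of_ge (by linarith) (by linarith)]
  · ring
  · refine ContinuousOn.sub (by fun_prop) (continuousOn_const.div continuousOn_id fun x hx => ?_)
    exact (ha.trans_le hx.1).ne'
  · intro x hx
    have hx0 : x ≠ 0 := (ha.trans_le hx.1).ne'
    have := (((hasDerivAt_id x).sub ((hasDerivAt_pow 2 x).div_const 2)).sub
      ((Real.hasDerivAt_log hx0).const_mul (a * (1 - a))))
    refine this.congr_deriv ?_
    norm_num
    ring

/-- The virtual value under the least favourable law, weighted by its density. -/
noncomputable def hardVirtual (a : ℝ) : ℝ → ℝ :=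
  splice a (1 - a) (fun _ => 0) fun x => 2 * x - 1

/-- By the envelope formula the weight of `q x` is `x` times the density minus the `ccdf`. On `[a, 1
- a]` both terms are `a (1 - a) / x` and cancel; outside, `x - (1 - x)` remains. -/
theorem integral_payment_hardLaw (ha : 0 < a) (ha' : a < 1 / 2) {q m : ℝ → ℝ}
    (h : IsMechanism q m) :
    ∫ v, m v ∂(hardLaw a) = m 0 + ∫ x in (0 : ℝ)..1, q x * hardVirtual a x := by
  have hP := isLawOnUnit_hardLaw ha ha'
  have := hP.1
  have hq := h.intervalIntegrable_alloc (s := 0) (t := 1) (by simp) (by simp)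
  have hv : IntervalIntegrable (fun x => q x * hardVirtual a x) volume 0 1 := by
    refine h.intervalIntegrable_alloc_mul
      (intervalIntegrable_splice continuousOn_const (by fun_prop) _ _)
  have hc : IntervalIntegrable (fun x => q x * ccdf (hardLaw a) x) volume 0 1 := by
    exact h.intervalIntegrable_alloc_mul (intervalIntegrable_ccdf _ _ _)
  rw [h.integral_payment hP, hardLaw, integral_densityLaw (intervalIntegrable_hardDensity ha _ _)
    (fun x _ => hardDensity_nonneg ha ha' x), ← hardLaw, add_sub_assoc, sub_eq_of_eq_add]
  rw [← intervalIntegral.integral_add hv hc]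
  refine intervalIntegral.integral_congr fun x hx => ?_
  rw [uIcc_of_le zero_le_one] at hx
  simp only [ccdf_hardLaw ha ha' hx, hardDensity, hardVirtual]
  by_cases h : x ∈ Icc a (1 - a)
  · have hx0 : x ≠ 0 := (ha.trans_le h.1).ne'
    rw [splice_of_mem h, splice_of_mem h, splice_of_mem h]
    field_simp; ring
  · rw [splice_of_notMem h, splice_of_notMem h, splice_of_notMem h]; ring

end hardLaw

section hardLaw

variable {a : ℝ} {q m : ℝ → ℝ}

theorem integral_indicator_mul_hardVirtual (ha : 0 < a) (ha' : a < 1 / 2) :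
    ∫ x in (0 : ℝ)..1, (Ioi (1 - a)).indicator 1 x * hardVirtual a x = a * (1 - a) := by
  have e : (fun x => (Ioi (1 - a)).indicator 1 x * hardVirtual a x) =
      (Ioi (1 - a)).indicator (hardVirtual a) := by
    ext x; by_cases hx : x ∈ Ioi (1 - a) <;> simp [hx]
  have e' : Ioc 0 1 ∩ Ioi (1 - a) = Ioc (1 - a) 1 := by
    ext x
    simp only [mem_inter_iff, mem_Ioi, mem_Ioc]
    exact ⟨fun h => ⟨h.2, h.1.2⟩, fun h => ⟨⟨by linarith [h.1], h.2⟩, h.1⟩⟩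
  rw [e, intervalIntegral.integral_of_le zero_le_one, setIntegral_indicator measurableSet_Ioi, e',
    setIntegral_congr_fun (f := hardVirtual a) (g := fun x => 2 * x - 1) measurableSet_Ioc
      fun x hx => splice_of_notMem fun h => hx.1.not_ge h.2,
    ← intervalIntegral.integral_of_le (by linarith),
    intervalIntegral.integral_sub
      ((by fun_prop : Continuous fun x : ℝ => 2 * x).intervalIntegrable _ _) intervalIntegrable_const,
    intervalIntegral.integral_const_mul, integral_id]
  simp
  ring

/-- The virtual value is negative below `a`, zero on `[a, 1 - a]` and positive above, so serving
exactly the types above `1 - a` maximizes pointwise among allocations in `[0, 1]`. -/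
theorem hardVirtual_slack_nonneg (ha : 0 < a) (ha' : a < 1 / 2) (h : IsMechanism q m) {x : ℝ}
    (hx : x ∈ Icc (0 : ℝ) 1) :
    0 ≤ (Ioi (1 - a)).indicator 1 x * hardVirtual a x - q x * hardVirtual a x := by
  have hq := h.alloc_mem x hx
  rw [← sub_mul]
  by_cases hm : x ∈ Icc a (1 - a)
  · rw [hardVirtual, splice_of_mem hm, mul_zero]
  · rw [hardVirtual, splice_of_notMem hm]
    rcases lt_or_ge x a with h' | h'
    · rw [indicator_of_notMem (by simp only [mem_Ioi, not_lt]; linarith)]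
      nlinarith [hq.1]
    · have : 1 - a < x := by by_contra! h''; exact hm ⟨h', h''⟩
      rw [indicator_of_mem (mem_Ioi.2 this), Pi.one_apply]
      exact mul_nonneg (by linarith [hq.2]) (by linarith)

theorem intervalIntegrable_hardVirtual (a : ℝ) :
    IntervalIntegrable (hardVirtual a) volume 0 1 :=
  intervalIntegrable_splice continuousOn_const (by fun_prop) _ _

theorem intervalIntegrable_indicator_mul_hardVirtual (a : ℝ) :
    IntervalIntegrable (fun x => (Ioi (1 - a)).indicator 1 x * hardVirtual a x) volume 0 1 := by
  have e : (fun x => (Ioi (1 - a)).indicator 1 x * hardVirtual a x) =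
      (Ioi (1 - a)).indicator (hardVirtual a) := by
    ext x; by_cases hx : x ∈ Ioi (1 - a) <;> simp [hx]
  have := intervalIntegrable_hardVirtual a
  rw [e, intervalIntegrable_iff] at *
  exact this.indicator measurableSet_Ioi

theorem integral_hardVirtual_slack (ha : 0 < a) (ha' : a < 1 / 2) (h : IsMechanism q m) :
    ∫ x in (0 : ℝ)..1, ((Ioi (1 - a)).indicator 1 x * hardVirtual a x - q x * hardVirtual a x) =
      a * (1 - a) + m 0 - ∫ v, m v ∂(hardLaw a) := by
  rw [intervalIntegral.integral_sub (intervalIntegrable_indicator_mul_hardVirtual a)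
    (h.intervalIntegrable_alloc_mul (intervalIntegrable_hardVirtual a)),
    integral_indicator_mul_hardVirtual ha ha', integral_payment_hardLaw ha ha' h]
  ring

theorem IsMechanism.payment_zero_nonpos (h : IsMechanism q m) : m 0 ≤ 0 := by
  have := h.rational 0 (by simp)
  linarith

/-- No mechanism earns more than `a (1 - a)` under the least favourable law. -/
theorem integral_payment_hardLaw_le (ha : 0 < a) (ha' : a < 1 / 2) (h : IsMechanism q m) :
    ∫ v, m v ∂(hardLaw a) ≤ a * (1 - a) := by
  have := intervalIntegral.integral_nonneg (μ := volume) zero_le_one fun x hx =>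
    hardVirtual_slack_nonneg ha ha' h hx
  rw [integral_hardVirtual_slack ha ha' h] at this
  linarith [h.payment_zero_nonpos]

/-- Mechanisms that are optimal under the least favourable law allocate to no type below `a` and
to all types above `1 - a`. -/
theorem alloc_of_le_integral_payment_hardLaw (ha : 0 < a) (ha' : a < 1 / 2) (h : IsMechanism q m)
    (hc : a * (1 - a) ≤ ∫ v, m v ∂(hardLaw a)) :
    m 0 = 0 ∧ (∀ x ∈ Ico 0 a, q x = 0) ∧ ∀ x ∈ Ioc (1 - a) 1, q x = 1 := by
  set N : ℝ → ℝ := fun x =>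
    (Ioi (1 - a)).indicator 1 x * hardVirtual a x - q x * hardVirtual a x with hN
  have hN0 : ∀ x ∈ Icc (0 : ℝ) 1, 0 ≤ N x := fun x hx => hardVirtual_slack_nonneg ha ha' h hx
  have hpos : 0 ≤ ∫ x in (0 : ℝ)..1, N x := intervalIntegral.integral_nonneg zero_le_one hN0
  have hI := integral_hardVirtual_slack ha ha' h
  have hm0 := h.payment_zero_nonpos
  have hNI : IntervalIntegrable N volume 0 1 :=
    (intervalIntegrable_indicator_mul_hardVirtual a).sub
      (h.intervalIntegrable_alloc_mul (intervalIntegrable_hardVirtual a))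
  have hz : ∫ x in (0 : ℝ)..1, N x = 0 := by linarith
  have hae : ∀ᵐ x ∂volume, x ∈ Ioc (0 : ℝ) 1 → N x = 0 := by
    rw [intervalIntegral.integral_of_le zero_le_one, setIntegral_eq_zero_iff_of_nonneg_ae] at hz
    · exact (ae_restrict_iff' measurableSet_Ioc).1 hz
    · exact (ae_restrict_iff' measurableSet_Ioc).2 (Filter.Eventually.of_forall fun x hx =>
        hN0 x ⟨hx.1.le, hx.2⟩)
    · exact (intervalIntegrable_iff_integrableOn_Ioc_of_le zero_le_one).1 hNI
  have hd := Measure.dense_of_ae hae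
  refine ⟨by linarith, fun x hx => ?_, fun x hx => ?_⟩
  -- The slack vanishes only almost everywhere; density gives a point `y` between `x` and `a` where
  -- `q y = 0`, and monotonicity carries this down to `x`.
  · obtain ⟨y, hy, hxy, hya⟩ := hd.exists_between hx.2
    have hy0 : 0 < y := hx.1.trans_lt hxy
    have := hy ⟨hy0, by linarith⟩
    simp only [hN, hardVirtual] at this
    rw [splice_of_notMem fun h => hya.not_ge h.1,
      indicator_of_notMem (by simp only [mem_Ioi, not_lt]; linarith)] at this
    have h2 : q y = 0 := by
      have : q y * (1 - 2 * y) = 0 := by linarith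
      exact (mul_eq_zero.1 this).resolve_right (by linarith)
    have hx1 : x ∈ Icc (0 : ℝ) 1 := ⟨hx.1, by linarith⟩
    exact le_antisymm (h2 ▸ h.monotoneOn_alloc hx1 ⟨hy0.le, by linarith⟩ hxy.le)
      (h.alloc_mem x hx1).1
  · obtain ⟨y, hy, hay, hyx⟩ := hd.exists_between hx.1
    have hy1 : y < 1 := hyx.trans_le hx.2
    have := hy ⟨by linarith, hy1.le⟩
    simp only [hN, hardVirtual] at this
    rw [splice_of_notMem fun h => hay.not_ge h.2, indicator_of_mem (mem_Ioi.2 hay)] at this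
    have h2 : q y = 1 := by
      have : (1 - q y) * (2 * y - 1) = 0 := by
        simp only [Pi.one_apply] at this; linarith
      have := (mul_eq_zero.1 this).resolve_right (by linarith)
      linarith
    have hx1 : x ∈ Icc (0 : ℝ) 1 := ⟨by linarith, hx.2⟩
    exact le_antisymm (h.alloc_mem x hx1).2
      (h2 ▸ h.monotoneOn_alloc ⟨by linarith, hy1.le⟩ hx1 hyx.le)

theorem real_Icc_hardLaw_pos (ha : 0 < a) (ha' : a < 1 / 2) {t w : ℝ} (ht : 0 ≤ t) (htw : t < w)
    (hw : w ≤ 1) : 0 < (hardLaw a).real (Icc t w) := by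
  have := (isLawOnUnit_hardLaw ha ha').1
  have hI := intervalIntegrable_hardDensity ha
  have e : (hardLaw a).real (Ioc t w) = ∫ x in t..w, hardDensity a x :=
    real_densityLaw (hI _ _) (fun x _ => hardDensity_nonneg ha ha' x) measurableSet_Ioc htw.le
      (inter_eq_left.2 (Ioc_subset_Ioc ht hw))
  have h1 : ∫ _ in t..w, a * (1 - a) ≤ ∫ x in t..w, hardDensity a x :=
    intervalIntegral.integral_mono_on htw.le (by simp) (hI _ _) fun x _ =>
      hardDensity_pos ha ha' x
  have h2 : 0 < ∫ _ in t..w, a * (1 - a) := by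
    rw [intervalIntegral.integral_const, smul_eq_mul]
    exact mul_pos (sub_pos.2 htw) (mul_pos ha (by linarith))
  have h3 : (hardLaw a).real (Ioc t w) ≤ (hardLaw a).real (Icc t w) :=
    measureReal_mono Ioc_subset_Icc_self
  linarith

end hardLaw

/-! ### Growth bounds from a binding constraint. -/

/-- If the satisficing constraint binds at a law of full support, then payments grow at rate at
most `k`: otherwise it would be violated by moving some mass to the left. -/
theorem Satisfices.payment_sub_le {P P₀ : Measure ℝ} [IsFiniteMeasure P₀] {τ k : ℝ} {m : ℝ → ℝ}
    (hsat : Satisfices P₀ τ m k) (hk : 0 < k) (hm : MonotoneOn m (Icc 0 1)) (hP : IsLawOnUnit P)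
    (htight : ∫ v, m v ∂P + k * wassersteinDist P P₀ ≤ τ)
    (hpos : ∀ t w : ℝ, 0 ≤ t → t < w → w ≤ 1 → 0 < P.real (Icc t w)) {s t : ℝ} (hs : 0 ≤ s)
    (hst : s ≤ t) (ht : t < 1) : m t - m s ≤ k * (t - s) := by
  by_contra! hlt
  have := hP.1
  -- The first bound keeps `[t, t + δ]` inside `[0, 1]`; the second makes `k δ` at most half of the
  -- assumed excess.
  set δ := min (1 - t) ((m t - m s - k * (t - s)) / (2 * k)) with hδ
  have hδ0 : 0 < δ := lt_min (by linarith) (div_pos (by linarith) (by linarith))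
  have hδ1 : δ ≤ 1 - t := min_le_left _ _
  have hδ2 : δ * (2 * k) ≤ m t - m s - k * (t - s) :=
    (le_div_iff₀ (by linarith)).1 (min_le_right _ _)
  have hB : MeasurableSet (Icc t (t + δ)) := measurableSet_Icc
  have hs' : s ∈ Icc (0 : ℝ) 1 := ⟨hs, by linarith⟩
  have ht' : t ∈ Icc (0 : ℝ) 1 := ⟨by linarith, by linarith⟩
  have hsB : ∀ b ∈ Icc t (t + δ), s ≤ b := fun b hb => hst.trans hb.1
  have hsub : Icc t (t + δ) ⊆ Icc 0 1 := Icc_subset_Icc ht'.1 (by linarith)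
  have hR := isLawOnUnit_relocate hP hB hs'
  have := hR.1
  have hmP := hP.integrable_of_monotoneOn hm
  have hidP : Integrable (fun v : ℝ => v) P := hP.integrable_of_continuousOn continuousOn_id
  have h1 := hsat _ hR
  have h2 := wassersteinDist_triangle (relocate P (Icc t (t + δ)) s) P P₀
  rw [integral_relocate hP hB hmP] at h1
  rw [wassersteinDist_relocate hP hB hs' hsB] at h2
  have h3 : P.real (Icc t (t + δ)) * m t ≤ ∫ v in Icc t (t + δ), m v ∂P := by
    rw [← smul_eq_mul, ← setIntegral_const]
    exact setIntegral_mono_on (integrable_const _).integrableOn hmP.integrableOn hB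
      fun x hx => hm ht' (hsub hx) hx.1
  have h4 : ∫ v in Icc t (t + δ), v ∂P ≤ P.real (Icc t (t + δ)) * (t + δ) := by
    rw [← smul_eq_mul, ← setIntegral_const]
    exact setIntegral_mono_on hidP.integrableOn (integrable_const _).integrableOn hB
      fun x hx => hx.2
  have h5 := hpos t (t + δ) ht'.1 (by linarith) (by linarith)
  set b := P.real (Icc t (t + δ))
  have h6 := mul_le_mul_of_nonneg_left h2 hk.le
  have h7 := mul_le_mul_of_nonneg_left h4 hk.le
  -- Moving the mass `b` from `[t, t + δ]` to `s` loses at least `b (m t - m s)` of revenue and adds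
  -- at most `b (t + δ - s)` to the distance, which breaks a binding constraint.
  have h8 : 0 < b * (m t - m s - k * (t + δ - s)) := mul_pos h5 (by nlinarith)
  nlinarith

/-- If payments grow at rate at most `k`, then allocations grow at most logarithmically. -/
theorem IsMechanism.alloc_sub_le {q m : ℝ → ℝ} (h : IsMechanism q m) {k : ℝ} (hk : 0 ≤ k)
    (hlip : ∀ s t : ℝ, 0 ≤ s → s ≤ t → t < 1 → m t - m s ≤ k * (t - s)) {x y : ℝ}
    (hx : 0 < x) (hxy : x ≤ y) (hy : y < 1) : q y - q x ≤ k * (Real.log y - Real.log x) := by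
  -- Incentive compatibility gives `q t - q s ≤ k (t - s) / s`, while `log (t / s) ≥ 1 - s / t`; the
  -- gap `k (t - s) (1 / s - 1 / t)` is the product form required, with `g z = -k / z`.
  have := le_of_sub_le_mul_sub (D := fun z => q z - k * Real.log z) (g := fun z => -(k / z)) hxy ?_
  · linarith
  intro s hs t ht hst
  have hs0 : 0 < s := hx.trans_le hs.1
  have ht0 : 0 < t := hx.trans_le ht.1
  have ht1 : t < 1 := ht.2.trans_lt hy
  have h1 := h.mul_alloc_sub_le (s := s) (t := t) ⟨hs0.le, by linarith⟩ ⟨ht0.le, ht1.le⟩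
  have h2 := hlip s t hs0.le hst ht1
  have h3 : q t - q s ≤ k * (t - s) / s := by
    rw [le_div_iff₀ hs0]; linarith
  have h4 := Real.one_sub_inv_le_log_of_pos (div_pos ht0 hs0)
  rw [Real.log_div ht0.ne' hs0.ne', inv_div] at h4
  have h5 := mul_le_mul_of_nonneg_left h4 hk
  have h6 : (t - s) * (-(k / t) - -(k / s)) = k * (t - s) / s - k * (1 - s / t) := by
    field_simp; ring
  linarith

theorem IsRandomizedPrice.eq_of_eqOn {Q R : Measure ℝ} {q m q' m' : ℝ → ℝ}
    (hQ : IsRandomizedPrice Q q m) (hR : IsRandomizedPrice R q' m') (h : EqOn q q' (Icc 0 1)) :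
    Q = R := by
  have := hQ.1.1
  have := hR.1.1
  refine Measure.ext_of_Iic _ _ fun v => ?_
  rcases lt_or_ge v 0 with hv | hv
  · have e : Iic v ⊆ (Icc (0 : ℝ) 1)ᶜ := fun x hx h => by
      have := h.1; have := mem_Iic.1 hx; linarith
    rw [measure_mono_null e hQ.1.2, measure_mono_null e hR.1.2]
  rcases le_or_gt v 1 with hv1 | hv1
  · rw [← ENNReal.toReal_eq_toReal_iff' (measure_ne_top _ _) (measure_ne_top _ _)]
    exact ((hQ.2 v ⟨hv, hv1⟩).1.symm.trans (h ⟨hv, hv1⟩)).trans (hR.2 v ⟨hv, hv1⟩).1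
  · have e : (Iic v)ᶜ ⊆ (Icc (0 : ℝ) 1)ᶜ := compl_subset_compl.2 fun x hx => hx.2.trans hv1.le
    rw [(prob_compl_eq_zero_iff measurableSet_Iic).1 (measure_mono_null e hQ.1.2),
      (prob_compl_eq_zero_iff measurableSet_Iic).1 (measure_mono_null e hR.1.2)]

/-! ### The robust mechanism: feasibility, optimality and uniqueness. -/

/-- The law of the random price with density `k / x` on `[a, 1 - a]`. -/
noncomputable def priceLaw (a k : ℝ) : Measure ℝ :=
  densityLaw (splice a (1 - a) (fun x => k / x) fun _ => 0)

/-- The payment rule that grows at rate `k` on `[a, 1 - a]` and is constant elsewhere. -/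
noncomputable def robustPayment (a k v : ℝ) : ℝ := k * (clamp a (1 - a) v - a)

/-- The distribution function of `priceLaw a k`. -/
noncomputable def robustAlloc (a k v : ℝ) : ℝ :=
  k * (Real.log (clamp a (1 - a) v) - Real.log a)

section

variable {a k τ : ℝ} {q m : ℝ → ℝ}

theorem continuousOn_priceDensity (ha : 0 < a) :
    ContinuousOn (fun x : ℝ => k / x) (Icc a (1 - a)) :=
  continuousOn_const.div continuousOn_id fun _ hx => (ha.trans_le hx.1).ne'

theorem intervalIntegrable_priceDensity (ha : 0 < a) (u v : ℝ) :
    IntervalIntegrable (splice a (1 - a) (fun x => k / x) fun _ => 0) volume u v :=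
  intervalIntegrable_splice (continuousOn_priceDensity ha) continuous_const u v

theorem priceDensity_nonneg (ha : 0 < a) (hk : 0 < k) (x : ℝ) :
    0 ≤ splice a (1 - a) (fun x => k / x) (fun _ => 0) x := by
  by_cases h : x ∈ Icc a (1 - a)
  · rw [splice_of_mem h]; exact div_nonneg hk.le (ha.le.trans h.1)
  · rw [splice_of_notMem h]

theorem integral_priceDensity (ha : 0 < a) (ha' : a < 1 / 2) (u v : ℝ) :
    ∫ x in u..v, splice a (1 - a) (fun x => k / x) (fun _ => 0) x =
      k * (Real.log (clamp a (1 - a) v) - Real.log (clamp a (1 - a) u)) := by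
  rw [integral_splice (F := fun x => k * Real.log x) (by linarith) (continuousOn_priceDensity ha)]
  · ring
  · intro x hx
    exact ((Real.hasDerivAt_log (ha.trans_le hx.1).ne').const_mul k).congr_deriv (by ring)

theorem isLawOnUnit_priceLaw (ha : 0 < a) (ha' : a < 1 / 2) (hk : 0 < k)
    (hkL : k * (Real.log (1 - a) - Real.log a) = 1) : IsLawOnUnit (priceLaw a k) := by
  refine isLawOnUnit_densityLaw (intervalIntegrable_priceDensity ha _ _)
    (fun x _ => priceDensity_nonneg ha hk x) ?_
  rw [integral_priceDensity ha ha', clamp_of_ge (by linarith) (by linarith), clamp_of_le ha.le, hkL]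

theorem integral_priceDensity_mul_pow (ha : 0 < a) (ha' : a < 1 / 2) (n : ℕ) (v : ℝ) :
    ∫ x in (0 : ℝ)..v, splice a (1 - a) (fun x => k / x) (fun _ => 0) x * x ^ (n + 1) =
      k * (clamp a (1 - a) v ^ (n + 1) - a ^ (n + 1)) / (n + 1) := by
  have e : ∀ x : ℝ, splice a (1 - a) (fun x => k / x) (fun _ => 0) x * x ^ (n + 1) =
      splice a (1 - a) (fun x => k * x ^ n) (fun _ => 0) x := by
    intro x
    by_cases h : x ∈ Icc a (1 - a)
    · have : x ≠ 0 := (ha.trans_le h.1).ne'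
      rw [splice_of_mem h, splice_of_mem h, pow_succ]; field_simp
    · rw [splice_of_notMem h, splice_of_notMem h, zero_mul]
  have hn : (n : ℝ) + 1 ≠ 0 := by positivity
  simp only [e]
  rw [integral_splice (F := fun x => k * x ^ (n + 1) / (n + 1)) (by linarith) (by fun_prop),
    clamp_of_le (x := 0) ha.le]
  · ring
  · intro x _
    refine (((hasDerivAt_pow (n + 1) x).const_mul k).div_const (n + 1 : ℝ)).congr_deriv ?_
    rw [Nat.add_sub_cancel]
    push_cast
    field_simp

theorem isRandomizedPrice_priceLaw (ha : 0 < a) (ha' : a < 1 / 2) (hk : 0 < k)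
    (hkL : k * (Real.log (1 - a) - Real.log a) = 1) :
    IsRandomizedPrice (priceLaw a k) (robustAlloc a k) (robustPayment a k) := by
  refine ⟨isLawOnUnit_priceLaw ha ha' hk hkL, fun v hv => ⟨?_, ?_⟩⟩
  · rw [priceLaw, real_Iic_densityLaw (intervalIntegrable_priceDensity ha _ _)
      (fun x _ => priceDensity_nonneg ha hk x) hv, integral_priceDensity ha ha',
      clamp_of_le (x := 0) ha.le, robustAlloc]
  · rw [priceLaw, setIntegral_Iic_densityLaw (intervalIntegrable_priceDensity ha _ _)
      (fun x _ => priceDensity_nonneg ha hk x) hv]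
    have := integral_priceDensity_mul_pow (k := k) ha ha' 0 v
    simp only [zero_add, pow_one] at this
    rw [this, robustPayment]
    simp

theorem moment_priceLaw (ha : 0 < a) (ha' : a < 1 / 2) (hk : 0 < k) (n : ℕ) :
    ∫ p, p ^ (n + 1) ∂(priceLaw a k) = k * ((1 - a) ^ (n + 1) - a ^ (n + 1)) / (n + 1) := by
  rw [priceLaw, integral_densityLaw (intervalIntegrable_priceDensity ha _ _)
    (fun x _ => priceDensity_nonneg ha hk x), integral_priceDensity_mul_pow ha ha' n 1,
    clamp_of_ge (by linarith) (by linarith)]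

/-- The expected payment is `k` times the integral of the `ccdf` over `[a, 1 - a]`. It equals `τ` at
the uniform law, and changing the law costs at most `k` times the pointwise difference of the
`ccdf`s. -/
theorem satisfices_robustPayment (ha : 0 < a) (ha' : a < 1 / 2) (hk : 0 < k)
    (hkτ : k * (1 - 2 * a) = 2 * τ) : Satisfices uniformLaw τ (robustPayment a k) k := by
  intro P hP
  have := hP.1
  have hunif := isLawOnUnit_uniformLaw.1
  have hI : IntervalIntegrable (splice a (1 - a) (fun _ => k) fun _ => 0) volume 0 1 :=
    intervalIntegrable_splice continuousOn_const continuous_const _ _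
  have e1 : robustPayment a k = fun v =>
      ∫ x in (0 : ℝ)..v, splice a (1 - a) (fun _ => k) (fun _ => 0) x := by
    ext v
    rw [integral_splice (F := fun x => k * x) (by linarith) continuousOn_const,
      clamp_of_le (x := 0) ha.le, robustPayment]
    · ring
    · intro x _; simpa using (hasDerivAt_id x).const_mul k
  have e2 : ∫ x in (0 : ℝ)..1, splice a (1 - a) (fun x => k * (1 - x)) (fun _ => 0) x = τ := by
    rw [integral_splice (F := fun x => k * (x - x ^ 2 / 2)) (by linarith) (by fun_prop),
      clamp_of_le (x := 0) ha.le, clamp_of_ge (by linarith) (by linarith)]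
    · linear_combination hkτ / 2
    · intro x _
      refine (((hasDerivAt_id x).sub ((hasDerivAt_pow 2 x).div_const 2)).const_mul k).congr_deriv ?_
      norm_num
  have e3 : IntervalIntegrable (splice a (1 - a) (fun x => k * (1 - x)) fun _ => 0) volume 0 1 :=
    intervalIntegrable_splice (by fun_prop) continuous_const _ _
  have e4 : IntervalIntegrable (fun x => k * |ccdf P x - ccdf uniformLaw x|) volume 0 1 :=
    (((intervalIntegrable_ccdf P 0 1).sub (intervalIntegrable_ccdf uniformLaw 0 1)).abs).const_mul k
  have e5 : IntervalIntegrable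
      (fun x => splice a (1 - a) (fun _ => k) (fun _ => 0) x * ccdf P x) volume 0 1 := by
    have h := intervalIntegrable_ccdf P 0 1
    rw [intervalIntegrable_iff] at h hI ⊢
    refine Integrable.bdd_mul (c := k) h hI.aestronglyMeasurable
      (Filter.Eventually.of_forall fun x => ?_)
    rw [Real.norm_eq_abs]
    unfold splice
    split_ifs
    · rw [abs_of_pos hk]
    · simpa using hk.le
  rw [e1, hP.integral_primitive hI, wassersteinDist, ← intervalIntegral.integral_const_mul,
    sub_le_iff_le_add, ← intervalIntegral.integral_add e4 e5]
  calc τ = _ := e2.symm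
    _ ≤ _ := intervalIntegral.integral_mono_on zero_le_one e3 (e4.add e5) fun x hx => by
      rw [ccdf_uniformLaw hx]
      by_cases h : x ∈ Icc a (1 - a)
      · rw [splice_of_mem h, splice_of_mem h]
        nlinarith [neg_abs_le (ccdf P x - (1 - x))]
      · rw [splice_of_notMem h, splice_of_notMem h]
        rw [zero_mul, add_zero]
        positivity

theorem isFeasibleRS_robust (ha : 0 < a) (ha' : a < 1 / 2) (hk : 0 < k)
    (hkL : k * (Real.log (1 - a) - Real.log a) = 1) (hkτ : k * (1 - 2 * a) = 2 * τ) :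
    IsFeasibleRS uniformLaw τ k (robustAlloc a k) (robustPayment a k) :=
  ⟨(isRandomizedPrice_priceLaw ha ha' hk hkL).isMechanism, hk,
    satisfices_robustPayment ha ha' hk hkτ⟩

/-- The right side is the maximal revenue under `hardLaw a` plus `k` times its distance to uniform:
the constraint binds there. -/
theorem target_eq (hkL : k * (Real.log (1 - a) - Real.log a) = 1)
    (hkτ : k * (1 - 2 * a) = 2 * τ) :
    τ = a * (1 - a) + k * ((1 - 2 * a) / 2 - a * (1 - a) * (Real.log (1 - a) - Real.log a)) := by
  linear_combination a * (1 - a) * hkL - hkτ / 2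

theorem fragility_ge (ha : 0 < a) (ha' : a < 1 / 2)
    (hkL : k * (Real.log (1 - a) - Real.log a) = 1) (hkτ : k * (1 - 2 * a) = 2 * τ)
    (hc : a * (1 - a) < τ) {k' : ℝ} (h : IsFeasibleRS uniformLaw τ k' q m) : k ≤ k' := by
  have h1 := h.2.2 _ (isLawOnUnit_hardLaw ha ha')
  have h2 := integral_payment_hardLaw_le ha ha' h.1
  have h3 := wassersteinDist_nonneg (hardLaw a) uniformLaw
  have h4 := target_eq hkL hkτ
  rw [← wassersteinDist_hardLaw ha ha'] at h4
  set d := wassersteinDist (hardLaw a) uniformLaw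
  have hd : 0 < d := h3.lt_of_ne fun h0 => by rw [← h0] at h4; linarith
  exact le_of_mul_le_mul_right (by linarith) hd

theorem eqOn_robust_of_isFeasibleRS (ha : 0 < a) (ha' : a < 1 / 2) (hk : 0 < k)
    (hkL : k * (Real.log (1 - a) - Real.log a) = 1) (hkτ : k * (1 - 2 * a) = 2 * τ)
    (h : IsFeasibleRS uniformLaw τ k q m) :
    EqOn q (robustAlloc a k) (Icc 0 1) ∧ EqOn m (robustPayment a k) (Icc 0 1) := by
  have hunif := isLawOnUnit_uniformLaw.1
  have h4 := target_eq hkL hkτ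
  rw [← wassersteinDist_hardLaw ha ha'] at h4
  have h1 := h.2.2 _ (isLawOnUnit_hardLaw ha ha')
  have h2 := integral_payment_hardLaw_le ha ha' h.1
  obtain ⟨hm0, hq0, hq1⟩ := alloc_of_le_integral_payment_hardLaw ha ha' h.1 (by linarith)
  have hlip : ∀ s t : ℝ, 0 ≤ s → s ≤ t → t < 1 → m t - m s ≤ k * (t - s) := fun s t hs hst ht =>
    h.2.2.payment_sub_le hk h.1.monotoneOn_payment (isLawOnUnit_hardLaw ha ha') (by linarith)
      (fun t w => real_Icc_hardLaw_pos ha ha') hs hst ht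
  have hlog : ∀ {x y : ℝ}, 0 < x → x ≤ y → y < 1 → q y - q x ≤ k * (Real.log y - Real.log x) :=
    fun hx hxy hy => h.1.alloc_sub_le hk.le hlip hx hxy hy
  have hq : EqOn q (robustAlloc a k) (Icc 0 1) := by
    intro v hv
    rw [robustAlloc]
    rcases lt_or_ge v a with hva | hva
    · rw [hq0 v ⟨hv.1, hva⟩, clamp_of_le hva.le, sub_self, mul_zero]
    rcases lt_or_ge (1 - a) v with hva' | hva'
    · rw [hq1 v ⟨hva', hv.2⟩, clamp_of_ge (by linarith) hva'.le, hkL]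
    rw [clamp_of_mem ⟨hva, hva'⟩]
    -- Revenue optimality does not fix `q` at `a` and `1 - a` themselves, so the logarithmic bound
    -- is applied from points outside `[a, 1 - a]` and passed to the limit. The upper bound from the
    -- left end and the lower bound from the right end coincide by `hkL`.
    have hcont : ∀ x : ℝ, 0 < x → ContinuousAt (fun s => k * (Real.log v - Real.log s)) x :=
      fun x hx => by
        have := Real.continuousAt_log hx.ne'
        fun_prop
    refine le_antisymm ?_ ?_
    · refine ge_of_tendsto ((hcont a ha).tendsto.mono_left (nhdsWithin_le_nhds (s := Iio a))) ?_
      filter_upwards [Ioo_mem_nhdsLT ha] with s hs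
      have := hlog hs.1 (hs.2.le.trans hva) (by linarith)
      rwa [hq0 s ⟨hs.1.le, hs.2⟩, sub_zero] at this
    · have h1a : 0 < 1 - a := by linarith
      have h5 : 1 - q v ≤ -(k * (Real.log v - Real.log (1 - a))) := by
        refine ge_of_tendsto
          ((hcont (1 - a) h1a).neg.tendsto.mono_left (nhdsWithin_le_nhds (s := Ioi (1 - a)))) ?_
        filter_upwards [Ioo_mem_nhdsGT (show 1 - a < 1 by linarith)] with t ht
        have := hlog (ha.trans_le hva) (hva'.trans ht.1.le) ht.2
        rw [hq1 t ⟨ht.1, ht.2.le⟩] at this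
        rw [Pi.neg_apply]
        linarith
      linarith
  refine ⟨hq, h.1.payment_congr (isRandomizedPrice_priceLaw ha ha' hk hkL).isMechanism hq ?_⟩
  rw [hm0, robustPayment, clamp_of_le ha.le, sub_self, mul_zero]

end

/-! ### Mean, variance and skewness of the optimal price. -/

section moments

variable {Q : Measure ℝ}

theorem lawVar_eq (hQ : IsLawOnUnit Q) : lawVar Q = ∫ p, p ^ 2 ∂Q - lawMean Q ^ 2 := by
  have := hQ.1
  have hm : MemLp (fun p : ℝ => p) 2 Q :=
    (memLp_two_iff_integrable_sq continuous_id.aestronglyMeasurable).2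
      (hQ.integrable_of_continuousOn (by fun_prop))
  rw [lawVar, variance_eq_sub hm, lawMean]
  rfl

theorem lawSkew_eq (hQ : IsLawOnUnit Q) :
    lawSkew Q = (∫ p, p ^ 3 ∂Q - 3 * lawMean Q * ∫ p, p ^ 2 ∂Q + 2 * lawMean Q ^ 3) /
      √(lawVar Q) ^ 3 := by
  have := hQ.1
  have h1 : Integrable (fun p : ℝ => p) Q := hQ.integrable_of_continuousOn (by fun_prop)
  have h2 : Integrable (fun p : ℝ => p ^ 2) Q := hQ.integrable_of_continuousOn (by fun_prop)
  have h3 : Integrable (fun p : ℝ => p ^ 3) Q := hQ.integrable_of_continuousOn (by fun_prop)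
  set μ := lawMean Q with hμ
  have e : ∀ p : ℝ, ((p - μ) / √(lawVar Q)) ^ 3 =
      (p ^ 3 - 3 * μ * p ^ 2 + (3 * μ ^ 2 * p - μ ^ 3)) / √(lawVar Q) ^ 3 := fun p => by
    rw [div_pow]; congr 1; ring
  have h4 : Integrable (fun p : ℝ => p ^ 3 - 3 * μ * p ^ 2) Q := h3.sub (h2.const_mul _)
  have h5 : Integrable (fun p : ℝ => 3 * μ ^ 2 * p - μ ^ 3) Q :=
    (h1.const_mul _).sub (integrable_const _)
  rw [lawSkew, ← hμ]
  simp only [e]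
  rw [integral_div, integral_add h4 h5, integral_sub h3 (h2.const_mul _),
    integral_sub (h1.const_mul _) (integrable_const _), integral_const_mul, integral_const_mul]
  have : ∫ p, p ∂Q = μ := hμ.symm
  rw [this]
  simp only [integral_const, probReal_univ, one_smul]
  congr 1
  ring

variable {a k τ : ℝ}

theorem priceLaw_mean (ha : 0 < a) (ha' : a < 1 / 2) (hk : 0 < k)
    (hkτ : k * (1 - 2 * a) = 2 * τ) : lawMean (priceLaw a k) = 2 * τ := by
  have := moment_priceLaw ha ha' hk 0
  simp only [zero_add, pow_one, Nat.cast_zero, div_one] at this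
  rw [lawMean, this]
  linear_combination hkτ

theorem priceLaw_sq (ha : 0 < a) (ha' : a < 1 / 2) (hk : 0 < k)
    (hkτ : k * (1 - 2 * a) = 2 * τ) : ∫ p, p ^ 2 ∂(priceLaw a k) = τ := by
  rw [moment_priceLaw ha ha' hk 1]
  push_cast
  linear_combination hkτ / 2

/-- Since `1 - 2a = 2τ / k`, the product `a (1 - a)` equals `1/4 - τ² / k²`; this is how `k` enters
the skewness, whereas it cancels from the first two moments. -/
theorem priceLaw_cube (ha : 0 < a) (ha' : a < 1 / 2) (hk : 0 < k)
    (hkτ : k * (1 - 2 * a) = 2 * τ) :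
    ∫ p, p ^ 3 ∂(priceLaw a k) = τ / 2 + 2 * τ ^ 3 / (3 * k ^ 2) := by
  rw [moment_priceLaw ha ha' hk 2]
  have : τ = k * (1 - 2 * a) / 2 := by linarith
  rw [this]
  push_cast
  field_simp
  ring

theorem priceLaw_var (ha : 0 < a) (ha' : a < 1 / 2) (hk : 0 < k)
    (hkL : k * (Real.log (1 - a) - Real.log a) = 1) (hkτ : k * (1 - 2 * a) = 2 * τ) :
    lawVar (priceLaw a k) = τ * (1 - 4 * τ) := by
  rw [lawVar_eq (isLawOnUnit_priceLaw ha ha' hk hkL), priceLaw_mean ha ha' hk hkτ,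
    priceLaw_sq ha ha' hk hkτ]
  ring

theorem priceLaw_skew (ha : 0 < a) (ha' : a < 1 / 2) (hk : 0 < k)
    (hkL : k * (Real.log (1 - a) - Real.log a) = 1) (hkτ : k * (1 - 2 * a) = 2 * τ)
    (hτ : 0 < τ) (hτ' : τ < 1 / 4) :
    lawSkew (priceLaw a k) = 1 / √(τ * (1 - 4 * τ) ^ 3) *
      (2 * τ ^ 2 / (3 * k ^ 2) + 1 / 2 - 6 * τ + 16 * τ ^ 2) := by
  rw [lawSkew_eq (isLawOnUnit_priceLaw ha ha' hk hkL), priceLaw_mean ha ha' hk hkτ,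
    priceLaw_sq ha ha' hk hkτ, priceLaw_cube ha ha' hk hkτ, priceLaw_var ha ha' hk hkL hkτ]
  have h4 : 0 < 1 - 4 * τ := by linarith
  have e : √(τ * (1 - 4 * τ)) ^ 3 = τ * √(τ * (1 - 4 * τ) ^ 3) := by
    have h1 : √(τ * (1 - 4 * τ)) ^ 3 = τ * (1 - 4 * τ) * √(τ * (1 - 4 * τ)) := by
      rw [pow_succ, Real.sq_sqrt (by positivity)]
    have h2 : √(τ * (1 - 4 * τ) ^ 3) = (1 - 4 * τ) * √(τ * (1 - 4 * τ)) := by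
      rw [show τ * (1 - 4 * τ) ^ 3 = (1 - 4 * τ) ^ 2 * (τ * (1 - 4 * τ)) by ring,
        Real.sqrt_mul (by positivity), Real.sqrt_sq h4.le]
    rw [h1, h2]; ring
  rw [e]
  have : 0 < √(τ * (1 - 4 * τ) ^ 3) := Real.sqrt_pos.2 (by positivity)
  field_simp
  ring

end moments

/-! ### Existence of the parameters. -/

/-- The support and the fragility of the optimal mechanism. -/
theorem exists_support_fragility {τ : ℝ} (hτ : 0 < τ) (hτ' : τ < 1 / 4) :
    ∃ a k : ℝ, 0 < a ∧ a < 1 / 2 ∧ 0 < k ∧ k * (Real.log (1 - a) - Real.log a) = 1 ∧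
      k * (1 - 2 * a) = 2 * τ := by
  -- Eliminating `k` leaves `h a = 0`, which also has the spurious root `1/2`. At `a₀` the log ratio
  -- is `1 / (2τ)`, so `h a₀ = -2 a₀`; at `2τ` the bound `log x ≤ x - 1` gives `h ≥ 0`. Both points
  -- lie strictly inside `(0, 1/2)`.
  set h : ℝ → ℝ := fun a => 1 - 2 * a - 2 * τ * (Real.log (1 - a) - Real.log a) with hh
  set r := Real.exp (1 / (2 * τ)) with hr
  have hr1 : 1 < r := Real.one_lt_exp_iff.2 (by positivity)
  set a₀ := 1 / (1 + r) with ha₀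
  have ha₀0 : 0 < a₀ := by positivity
  have ha₀1 : a₀ < 1 / 2 := one_div_lt_one_div_of_lt (by norm_num) (by linarith)
  have hsub : uIcc a₀ (2 * τ) ⊆ Ioo 0 (1 / 2) :=
    ordConnected_Ioo.uIcc_subset ⟨ha₀0, ha₀1⟩ ⟨by linarith, by linarith⟩
  have hcont : ContinuousOn h (uIcc a₀ (2 * τ)) := by
    intro x hx
    have h1 := Real.continuousAt_log (hsub hx).1.ne'
    have h2 : ContinuousAt (fun x => Real.log (1 - x)) x :=
      ContinuousAt.log (by fun_prop) (by have := (hsub hx).2; linarith)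
    refine ContinuousAt.continuousWithinAt ?_
    fun_prop
  have h0 : h a₀ ≤ 0 := by
    have e1 : 1 - a₀ = r * a₀ := by rw [ha₀]; field_simp; ring
    have e2 : Real.log (1 - a₀) - Real.log a₀ = 1 / (2 * τ) := by
      rw [e1, Real.log_mul (by positivity) ha₀0.ne', hr, Real.log_exp]; ring
    simp only [hh]
    rw [e2]
    have : 2 * τ * (1 / (2 * τ)) = 1 := by field_simp
    linarith
  have h1 : 0 ≤ h (2 * τ) := by
    have h1 : 0 < 1 - 2 * τ := by linarith
    have e := Real.log_le_sub_one_of_pos (div_pos h1 (show 0 < 2 * τ by linarith))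
    rw [Real.log_div h1.ne' (by positivity)] at e
    have e2 := mul_le_mul_of_nonneg_left e (show 0 ≤ 2 * τ by linarith)
    have : 2 * τ * ((1 - 2 * τ) / (2 * τ) - 1) = 1 - 4 * τ := by field_simp; ring
    simp only [hh]
    linarith
  obtain ⟨a, ha, hza⟩ := intermediate_value_uIcc hcont
    (show (0 : ℝ) ∈ uIcc (h a₀) (h (2 * τ)) by rw [uIcc_of_le (h0.trans h1)]; exact ⟨h0, h1⟩)
  obtain ⟨ha0, ha1⟩ := hsub ha
  have hL : 0 < Real.log (1 - a) - Real.log a := sub_pos.2 (Real.log_lt_log ha0 (by linarith))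
  refine ⟨a, 1 / (Real.log (1 - a) - Real.log a), ha0, ha1, by positivity, by field_simp, ?_⟩
  simp only [hh] at hza
  field_simp
  linarith

/-- This is `L < sinh L` for `L = log ((1 - a) / a)`, multiplied by `k = 1 / L`. It forces the least
favourable law to be at positive distance from uniform. -/
theorem mul_one_sub_lt_target {a k τ : ℝ} (ha : 0 < a) (ha' : a < 1 / 2) (hk : 0 < k)
    (hkL : k * (Real.log (1 - a) - Real.log a) = 1) (hkτ : k * (1 - 2 * a) = 2 * τ) :
    a * (1 - a) < τ := by
  have h1a : 0 < 1 - a := by linarith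
  have hL : 0 < Real.log (1 - a) - Real.log a := sub_pos.2 (Real.log_lt_log ha (by linarith))
  have h := Real.self_lt_sinh_iff.2 hL
  rw [Real.sinh_eq, neg_sub, Real.exp_sub, Real.exp_sub, Real.exp_log ha, Real.exp_log h1a] at h
  have e : ((1 - a) / a - a / (1 - a)) / 2 = (1 - 2 * a) / (2 * (a * (1 - a))) := by
    field_simp; ring
  have hc : 0 < a * (1 - a) := mul_pos ha h1a
  rw [e, lt_div_iff₀ (by positivity)] at h
  have := mul_lt_mul_of_pos_left h hk
  nlinarith

/-! ### The posted-price problem. -/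

section posted

variable {τ k p : ℝ}

theorem monotone_postedPayment (hp : 0 ≤ p) : Monotone (postedPayment p) := by
  intro x y hxy
  unfold postedPayment
  simp only [indicator, mem_Ici]
  split_ifs <;> linarith

theorem integral_postedPayment (P : Measure ℝ) (p : ℝ) :
    ∫ v, postedPayment p v ∂P = P.real (Ici p) * p := by
  rw [postedPayment, integral_indicator_const _ measurableSet_Ici, smul_eq_mul]

theorem uniformLaw_restrict_Icc {u w : ℝ} (hu : 0 ≤ u) (hw : w ≤ 1) :
    uniformLaw.restrict (Icc u w) = volume.restrict (Icc u w) := by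
  rw [uniformLaw, Measure.restrict_restrict measurableSet_Icc,
    inter_eq_left.2 (Icc_subset_Icc hu hw)]

theorem uniformLaw_real_Icc {u w : ℝ} (hu : 0 ≤ u) (huw : u ≤ w) (hw : w ≤ 1) :
    uniformLaw.real (Icc u w) = w - u := by
  rw [← measureReal_restrict_apply_self, uniformLaw_restrict_Icc hu hw,
    measureReal_restrict_apply_self, Real.volume_real_Icc_of_le huw]

theorem uniformLaw_real_Ici (hp : p ∈ Icc (0 : ℝ) 1) : uniformLaw.real (Ici p) = 1 - p := by
  have := isLawOnUnit_uniformLaw.1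
  have e : uniformLaw.real (Ici p) = uniformLaw.real (Icc p 1) := by
    refine measureReal_congr ?_
    filter_upwards [isLawOnUnit_uniformLaw.ae_mem] with x hx
    exact propext ⟨fun h => ⟨h, hx.2⟩, fun h => h.1⟩
  rw [e, uniformLaw_real_Icc hp.1 hp.2 le_rfl]

/-- The constraint at the laws that undercut the posted price on a part of the demand. -/
theorem posted_constraint (hp : p ∈ Icc (0 : ℝ) 1) (hp0 : 0 < p)
    (h : Satisfices uniformLaw τ (postedPayment p) k) {y : ℝ} (hy : 0 ≤ y) (hy1 : y ≤ 1 - p) :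
    τ - p * (1 - p) + p * y ≤ k * (y ^ 2 / 2) := by
  have hU := isLawOnUnit_uniformLaw
  have := hU.1
  have hw : p + y ≤ 1 := by linarith
  have hB : MeasurableSet (Icc p (p + y)) := measurableSet_Icc
  -- A buyer exactly at `p` still pays, so the mass is moved to `s < p`; the bound follows as `s`
  -- tends to `p`.
  have key : ∀ s ∈ Ioo 0 p, τ - p * (1 - p) + p * y ≤ k * (y ^ 2 / 2 + (p - s) * y) := by
    intro s hs
    have hs' : s ∈ Icc (0 : ℝ) 1 := ⟨hs.1.le, hs.2.le.trans hp.2⟩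
    have hsB : ∀ b ∈ Icc p (p + y), s ≤ b := fun b hb => hs.2.le.trans hb.1
    have h1 := h _ (isLawOnUnit_relocate hU hB hs')
    have h3 : ∫ v in Icc p (p + y), postedPayment p v ∂uniformLaw = y * p := by
      rw [setIntegral_congr_fun (g := fun _ => p) hB fun x hx => indicator_of_mem hx.1 _,
        setIntegral_const, uniformLaw_real_Icc hp.1 (by linarith) hw, smul_eq_mul]
      ring
    have h4 : ∫ v in Icc p (p + y), v ∂uniformLaw = ((p + y) ^ 2 - p ^ 2) / 2 := by
      rw [uniformLaw_restrict_Icc hp.1 hw, integral_Icc_eq_integral_Ioc,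
        ← intervalIntegral.integral_of_le (by linarith), integral_id]
    have h5 : postedPayment p s = 0 := indicator_of_notMem (by simpa using hs.2) _
    rw [integral_relocate hU hB
      (hU.integrable_of_monotoneOn ((monotone_postedPayment hp.1).monotoneOn _)), h3, h5,
      integral_postedPayment, uniformLaw_real_Ici hp, wassersteinDist_relocate hU hB hs' hsB, h4,
      uniformLaw_real_Icc hp.1 (by linarith) hw] at h1
    linarith
  have hc : ContinuousAt (fun s => k * (y ^ 2 / 2 + (p - s) * y)) p := by fun_prop
  have := ge_of_tendsto (hc.tendsto.mono_left (nhdsWithin_le_nhds (s := Iio p)))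
    (by filter_upwards [Ioo_mem_nhdsLT hp0] with s hs using key s hs)
  simpa using this

theorem IsFeasiblePP.fragility_ge (hτ : 0 < τ) (hτ' : τ < 1 / 4)
    (h : IsFeasiblePP uniformLaw τ k p) :
    2 * τ / (1 - 4 * τ) ≤ k ∧ (k = 2 * τ / (1 - 4 * τ) → p = 2 * τ) := by
  obtain ⟨hp, hk, hs⟩ := h
  have h4 : 0 < 1 - 4 * τ := by linarith
  have h0 := hs _ isLawOnUnit_uniformLaw
  rw [integral_postedPayment, uniformLaw_real_Ici hp] at h0
  simp only [wassersteinDist, sub_self, abs_zero, intervalIntegral.integral_zero, mul_zero] at h0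
  have hp0 : 0 < p := hp.1.lt_of_ne fun e => by rw [← e] at h0; linarith
  have hp1 : p < 1 := hp.2.lt_of_ne fun e => by rw [e] at h0; linarith
  rw [div_le_iff₀ h4, eq_div_iff h4.ne']
  -- The mass `y = p / k` maximizes `p y - k y² / 2`; it is available when it does not exceed the
  -- demand `1 - p`. Otherwise all demand is moved, which yields a strict bound on `k`.
  rcases le_or_gt p (k * (1 - p)) with hc | hc
  · have h1 := posted_constraint hp hp0 hs (y := p / k) (by positivity)
      ((div_le_iff₀' hk).2 hc)
    have e : k * (τ - p * (1 - p) + p * (p / k)) - k * (k * ((p / k) ^ 2 / 2)) =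
        k * (τ - p * (1 - p)) + p ^ 2 / 2 := by field_simp; ring
    have h2 := mul_le_mul_of_nonneg_left h1 hk.le
    -- Completing the square in `p`: the right side must be nonnegative, and when it is zero the
    -- price is determined.
    have h3 : ((1 + 2 * k) * p - k) ^ 2 ≤ k * (k * (1 - 4 * τ) - 2 * τ) := by
      have h5 : k * (τ - p * (1 - p)) + p ^ 2 / 2 ≤ 0 := by linarith
      nlinarith
    refine ⟨?_, fun hk' => ?_⟩
    · have := nonneg_of_mul_nonneg_right ((sq_nonneg _).trans h3) hk
      linarith
    · rw [hk', sub_self, mul_zero] at h3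
      have h6 : (1 + 2 * k) * p - k = 0 := pow_eq_zero_iff two_ne_zero |>.1
        (le_antisymm h3 (sq_nonneg _))
      have h7 : (1 + 2 * k) * (p - 2 * τ) = 0 := by linarith
      have := (mul_eq_zero.1 h7).resolve_left (by positivity)
      linarith
  · have h1 := posted_constraint hp hp0 hs (y := 1 - p) (by linarith) le_rfl
    have h2 : k * (1 - p) * (1 - p) < p * (1 - p) := mul_lt_mul_of_pos_right hc (by linarith)
    have h3 : (1 - p) ^ 2 < 1 - 4 * τ := by nlinarith
    have h5 := mul_lt_mul_of_pos_left h3 hk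
    exact ⟨by linarith, fun e => by linarith⟩

theorem isFeasiblePP_two_mul (hτ : 0 < τ) (hτ' : τ < 1 / 4) :
    IsFeasiblePP uniformLaw τ (2 * τ / (1 - 4 * τ)) (2 * τ) := by
  have h4 : 0 < 1 - 4 * τ := by linarith
  have hp : 2 * τ ∈ Icc (0 : ℝ) 1 := ⟨by linarith, by linarith⟩
  set k := 2 * τ / (1 - 4 * τ) with hk
  have hk0 : 0 < k := by positivity
  refine ⟨hp, hk0, fun P hP => ?_⟩
  have := hP.1
  have := isLawOnUnit_uniformLaw.1
  rw [integral_postedPayment]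
  set F := P.real (Ici (2 * τ)) with hF
  have hF0 : 0 ≤ F := measureReal_nonneg
  rcases le_or_gt (1 - 2 * τ) F with hc | hc
  · have := mul_nonneg hk0.le (wassersteinDist_nonneg P uniformLaw)
    nlinarith
  -- To the right of `2τ` the `ccdf` of `P` is at most `F`, while the uniform one stays above `F` up
  -- to `1 - F`; the distance contains the triangle between them.
  · have hd : (1 - 2 * τ - F) ^ 2 / 2 ≤ wassersteinDist P uniformLaw := by
      have hI : ∀ u w : ℝ, IntervalIntegrable
          (fun x => |ccdf P x - ccdf uniformLaw x|) volume u w := fun u w =>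
        ((intervalIntegrable_ccdf P u w).sub (intervalIntegrable_ccdf uniformLaw u w)).abs
      have h1 : ∫ x in (2 * τ)..(1 - F), (1 - F - x) ≤
          ∫ x in (2 * τ)..(1 - F), |ccdf P x - ccdf uniformLaw x| := by
        refine intervalIntegral.integral_mono_on (by linarith)
          ((by fun_prop : Continuous fun x : ℝ => 1 - F - x).intervalIntegrable _ _) (hI _ _)
          fun x hx => ?_
        rw [ccdf_uniformLaw ⟨by linarith [hx.1], by linarith [hx.2]⟩, abs_sub_comm]
        have : ccdf P x ≤ F := measureReal_mono fun z hz => hx.1.trans (le_of_lt hz)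
        linarith [le_abs_self (1 - x - ccdf P x)]
      have h2 : ∫ x in (2 * τ)..(1 - F), |ccdf P x - ccdf uniformLaw x| ≤
          wassersteinDist P uniformLaw :=
        intervalIntegral.integral_mono_interval hp.1 (by linarith) (by linarith)
          (Filter.Eventually.of_forall fun x => abs_nonneg _) (hI 0 1)
      have h3 : ∫ x in (2 * τ)..(1 - F), (1 - F - x) = (1 - 2 * τ - F) ^ 2 / 2 := by
        rw [intervalIntegral.integral_sub intervalIntegrable_const
          (continuous_id'.intervalIntegrable _ _), intervalIntegral.integral_const, integral_id,
          smul_eq_mul]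
        ring
      linarith
    have h5 := mul_le_mul_of_nonneg_left hd hk0.le
    refine le_trans ?_ h5
    set y := 1 - 2 * τ - F with hy
    have hkm : k * (1 - 4 * τ) = 2 * τ := div_mul_cancel₀ _ h4.ne'
    -- With this `k` the slack is a perfect square in `y`, vanishing at `y = 1 - 4τ`.
    have e : k * (y ^ 2 / 2) - (τ - F * (2 * τ)) = k / 2 * (y - (1 - 4 * τ)) ^ 2 := by
      linear_combination (y - (1 - 4 * τ) / 2) * hkm + 2 * τ * hy
    have : 0 ≤ k / 2 * (y - (1 - 4 * τ)) ^ 2 := by positivity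
    linarith

theorem isOptimalPP_two_mul (hτ : 0 < τ) (hτ' : τ < 1 / 4) :
    IsOptimalPP uniformLaw τ (2 * τ / (1 - 4 * τ)) (2 * τ) :=
  ⟨isFeasiblePP_two_mul hτ hτ', fun _ _ h => (h.fragility_ge hτ hτ').1⟩

theorem IsOptimalPP.price_eq (hτ : 0 < τ) (hτ' : τ < 1 / 4) (h : IsOptimalPP uniformLaw τ k p) :
    p = 2 * τ :=
  (h.1.fragility_ge hτ hτ').2 (le_antisymm (h.2 _ _ (isFeasiblePP_two_mul hτ hτ'))
    (h.1.fragility_ge hτ hτ').1)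

end posted

/-! ### The main theorem. -/

theorem proposition7 (τ : ℝ) (hτ_pos : 0 < τ) (hτ_lt : τ < 1 / 4) :
    (∃ (k : ℝ) (q m : ℝ → ℝ), IsOptimalRS uniformLaw τ k q m) ∧
    (∃ kPP pPP : ℝ, IsOptimalPP uniformLaw τ kPP pPP) ∧
    ∀ (k : ℝ) (q m : ℝ → ℝ), IsOptimalRS uniformLaw τ k q m →
    ∀ kPP pPP : ℝ, IsOptimalPP uniformLaw τ kPP pPP →
      (∃ Q : Measure ℝ, IsRandomizedPrice Q q m) ∧
      ∀ Q : Measure ℝ, IsRandomizedPrice Q q m →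
        lawMean Q = pPP ∧
        pPP = 2 * τ ∧
        lawVar Q = τ * (1 - 4 * τ) ∧
        lawSkew Q = 1 / √(τ * (1 - 4 * τ) ^ 3) *
          (2 * τ ^ 2 / (3 * k ^ 2) + 1 / 2 - 6 * τ + 16 * τ ^ 2) := by
  obtain ⟨a, k₀, ha, ha', hk, hkL, hkτ⟩ := exists_support_fragility hτ_pos hτ_lt
  have hc := mul_one_sub_lt_target ha ha' hk hkL hkτ
  have hopt : IsOptimalRS uniformLaw τ k₀ (robustAlloc a k₀) (robustPayment a k₀) :=
    ⟨isFeasibleRS_robust ha ha' hk hkL hkτ, fun _ _ _ h => fragility_ge ha ha' hkL hkτ hc h⟩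
  refine ⟨⟨_, _, _, hopt⟩, ⟨_, _, isOptimalPP_two_mul hτ_pos hτ_lt⟩, ?_⟩
  intro k q m hqm kPP pPP hPP
  obtain rfl : k = k₀ := le_antisymm (hqm.2 _ _ _ hopt.1) (hopt.2 _ _ _ hqm.1)
  obtain ⟨hq, hm⟩ := eqOn_robust_of_isFeasibleRS ha ha' hk hkL hkτ hqm.1
  have hR := isRandomizedPrice_priceLaw ha ha' hk hkL
  have hp := hPP.price_eq hτ_pos hτ_lt
  refine ⟨⟨priceLaw a k, hR.1, fun v hv => ?_⟩, fun Q hQ => ?_⟩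
  · rw [hq hv, hm hv]; exact hR.2 v hv
  · obtain rfl := hQ.eq_of_eqOn hR hq
    exact ⟨(priceLaw_mean ha ha' hk hkτ).trans hp.symm, hp, priceLaw_var ha ha' hk hkL hkτ,
      priceLaw_skew ha ha' hk hkL hkτ hτ_pos hτ_lt⟩
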